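/- Let $p$ be a prime, let $G=\mathbb{F}_p^{(\omega)}$ be the group of finitely supported sequences in $\mathbb{F}_p$, and let $\mathcal{M}=(G,\mathbb{F}_p,0,+,\cdot)$ be the two-sorted structure in which $0$ is the neutral element of $G$, $+$ is the addition of $G$, and $\cdot\colon G\times G\to\mathbb{F}_p$ is the bilinear form $(a_i)_i\cdot(b_i)_i=\sum_i a_ib_i$. Let $T$ be the complete first-order theory of $\mathcal{M}$. A formula $\psi(\bar y_0,\dots,\bar y_{n-1};\bar x)$ has the $n$-independence property in $T$ if in some model $N$ of $T$ there are tuples $\bar a^j_i$ ($i\in\omega$, $j<n$) and $\bar b_I$ ($I\subseteq\omega^n$) such that $N\models\psi(\bar a^0_{i_0},\dots,\bar a^{n-1}_{i_{n-1}};\bar b_I)$ if and only if $(i_0,\dots,i_{n-1})\in I$. The theory $T$ is $n$-dependent if no formula has the $n$-independence property in $T$; the independence property is the $1$-independence property. The theory $T$ is simple if no formula has the tree property in $T$. For a model $N$ of $T$ and a set $A$ of elements of $N$, let $G^0_A(N)$ be the intersection of all $A$-definable subgroups of finite index of $G(N)$, and let $G^{00}_A(N)$ be the intersection of all subgroups of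 bounded index of $G(N)$ that are type-definable over $A$. Here a partial type over $A$ defines a type-definable subgroup of bounded index if in every elementary extension of $N$ its solution set is a subgroup of $G$ whose index is at most a cardinal that does not depend on the extension. Then the following hold. 1. $T$ is $2$-dependent. 2. $T$ is simple. 3. $T$ has the independence property. 4. $G$ has no absolute connected component: it is not the case that $G^0_A(N)=G^0_\emptyset(N)$ for all models $N$ of $T$ and all $A\subseteq N$, and it is not the case that $G^{00}_A(N)=G^{00}_\emptyset(N)$ for all such $N$ and $A$. 5. There is no minimal type-definable subgroup of bounded index: for every model $N$ of $T$ and every type-definable subgroup $H$ of bounded index of $G$, over parameters from $N$, there are an elementary extension $N'$ of $N$ and a type-definable subgroup of bounded index, over parameters from $N'$, whose set of points in $N'$ is properly contained in $H(N')$. -/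

import Mathlib

open scoped FirstOrder

/-! ### Dividing lines for first-order theories -/

namespace ModelDividing

universe u v

variable {L : FirstOrder.Language.{u, v}}

/-- The formula `ψ(ȳ₀, …, ȳₙ₋₁; x̄)`, with `|ȳⱼ| = k j` and `|x̄| = m`, has the `n`-independence
property in `T`: in some model there are tuples `a j i` (`j < n`, `i ∈ ω`) and `b I` (`I ⊆ ωⁿ`) with
`ψ(a 0 (i 0), …, a (n-1) (i (n-1)); b I)` if and only if `i ∈ I`. -/
def FormulaHasIP (T : L.Theory) {n : ℕ} {k : Fin n → ℕ} {m : ℕ}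
    (ψ : L.Formula ((Σ j : Fin n, Fin (k j)) ⊕ Fin m)) : Prop :=
  ∃ (N : FirstOrder.Language.Theory.ModelType.{u, v, max u v} T)
    (a : (j : Fin n) → ℕ → Fin (k j) → N) (b : Set (Fin n → ℕ) → Fin m → N),
    ∀ (I : Set (Fin n → ℕ)) (i : Fin n → ℕ),
      ψ.Realize (Sum.elim (fun y => a y.1 (i y.1) y.2) (b I)) ↔ i ∈ I

/-- `T` has the `n`-independence property. For `n = 1` this is the independence property. -/
def HasIP (n : ℕ) (T : L.Theory) : Prop :=
  ∃ (k : Fin n → ℕ) (m : ℕ) (ψ : L.Formula ((Σ j : Fin n, Fin (k j)) ⊕ Fin m)), FormulaHasIP T ψ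

/-- `T` is `n`-dependent. -/
def IsDependent (n : ℕ) (T : L.Theory) : Prop := ¬ HasIP n T

/-- The formula `φ(x̄; ȳ)` has the tree property in `T`: in some model there are a number `k ≥ 2`
and a tree of tuples `a s`, `s ∈ ω^{<ω}`, such that the formulas `φ(x̄; a s)` along each branch `σ`
are (finitely) consistent, while at each node `s` the formulas `φ(x̄; a (s⌢i))`, `i ∈ ω`, are
`k`-inconsistent. -/
def FormulaHasTP (T : L.Theory) {m l : ℕ} (φ : L.Formula (Fin m ⊕ Fin l)) : Prop :=
  ∃ (N : FirstOrder.Language.Theory.ModelType.{u, v, max u v} T) (k : ℕ) (a : List ℕ → Fin l → N),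
    2 ≤ k ∧
    (∀ (σ : ℕ → ℕ) (d : ℕ), ∃ x : Fin m → N, ∀ e < d,
      φ.Realize (Sum.elim x (a (List.ofFn fun i : Fin (e + 1) => σ i)))) ∧
    (∀ (s : List ℕ) (J : Finset ℕ), J.card = k →
      ¬ ∃ x : Fin m → N, ∀ i ∈ J, φ.Realize (Sum.elim x (a (s ++ [i]))))

/-- `T` is simple: no formula has the tree property. -/
def IsSimpleTheory (T : L.Theory) : Prop :=
  ∀ (m l : ℕ) (φ : L.Formula (Fin m ⊕ Fin l)), ¬ FormulaHasTP T φ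

end ModelDividing

/-! ### The two-sorted structure `(𝔽_p^(ω), 𝔽_p, 0, +, ·)` -/

namespace BilinearSpace

/-- The constant symbol `0`. -/
inductive Func : ℕ → Type
  | zero : Func 0

/-- The two sorts, and the graphs of addition and of the bilinear form. -/
inductive Rel : ℕ → Type
  | vec : Rel 1
  | scal : Rel 1
  | add : Rel 3
  | dot : Rel 3

/-- The language of `(V, F, 0, +, ·)`, with the two sorts given as unary predicates. -/
def lang : FirstOrder.Language.{0, 0} := ⟨Func, Rel⟩

/-- The disjoint union of the sorts `𝔽_p^(ω)` and `𝔽_p`. -/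
inductive Carrier (p : ℕ) : Type
  | vec (x : ℕ →₀ ZMod p) : Carrier p
  | scal (c : ZMod p) : Carrier p

/-- The bilinear form `x · y = ∑ᵢ xᵢ yᵢ`. -/
def form {p : ℕ} (x y : ℕ →₀ ZMod p) : ZMod p := ∑ i ∈ x.support, x i * y i

instance instStructure (p : ℕ) : lang.Structure (Carrier p) where
  funMap := fun {_} f _ => match f with
    | Func.zero => Carrier.vec 0
  RelMap := fun {_} r => match r with
    | Rel.vec => fun t => ∃ x, t 0 = Carrier.vec x
    | Rel.scal => fun t => ∃ c, t 0 = Carrier.scal c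
    | Rel.add => fun t => ∃ x y, t 0 = Carrier.vec x ∧ t 1 = Carrier.vec y ∧
        t 2 = Carrier.vec (x + y)
    | Rel.dot => fun t => ∃ x y, t 0 = Carrier.vec x ∧ t 1 = Carrier.vec y ∧
        t 2 = Carrier.scal (form x y)

/-- The complete theory of `(𝔽_p^(ω), 𝔽_p, 0, +, ·)`. -/
def theory (p : ℕ) : lang.Theory := lang.completeTheory (Carrier p)

/-! ### Subgroups of the vector sort and connected components -/

section Group

variable {N : Type} [lang.Structure N]

/-- `x` belongs to the group `G(N)`, the vector sort of `N`. -/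
def IsVec (x : N) : Prop := FirstOrder.Language.Structure.RelMap (L := lang) Rel.vec ![x]

/-- `x + y = z` in `G(N)`. -/
def IsAdd (x y z : N) : Prop := FirstOrder.Language.Structure.RelMap (L := lang) Rel.add ![x, y, z]

/-- The neutral element of `G(N)`. -/
def zeroVec (N : Type) [lang.Structure N] : N := FirstOrder.Language.Structure.funMap (L := lang) Func.zero ![]

/-- `H` is a subgroup of `G(N)`. -/
def IsSubgroup (H : Set N) : Prop :=
  (∀ x ∈ H, IsVec x) ∧ zeroVec N ∈ H ∧
    (∀ x ∈ H, ∀ y ∈ H, ∀ z, IsAdd x y z → z ∈ H) ∧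
    (∀ x ∈ H, ∀ y, IsAdd x y (zeroVec N) → y ∈ H)

/-- The set of cosets `g + H`, `g ∈ G(N)`; its cardinality is the index of `H` in `G(N)`. -/
def cosets (H : Set N) : Set (Set N) :=
  {C | ∃ g : N, IsVec g ∧ C = {z | ∃ h ∈ H, IsAdd g h z}}

/-- `G⁰_A(N)`: the intersection of all `A`-definable subgroups of `G(N)` of finite index. -/
def finComponent (A : Set N) : Set N :=
  ⋂₀ {H | A.Definable₁ lang H ∧ IsSubgroup H ∧ (cosets H).Finite}

/-- The set of solutions in `N'` of the partial type `π(x)` over `A`, where the parameters from `A`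
are interpreted in `N'` by `f`. -/
def solutions {A : Set N} (π : Set (lang.Formula (A ⊕ Unit))) {N' : Type} [lang.Structure N']
    (f : N → N') : Set N' :=
  {x | ∀ φ ∈ π, φ.Realize (Sum.elim (fun a : A => f a) fun _ => x)}

/-- The partial type `π(x)` over `A ⊆ N` defines a type-definable subgroup of bounded index of `G`:
in all elementary extensions of `N` its solutions form a subgroup, and the index of this subgroup
is bounded by a cardinal that does not depend on the extension. -/
def IsBoundedSubgroup {A : Set N} (π : Set (lang.Formula (A ⊕ Unit))) : Prop :=
  ∃ κ : Cardinal.{0}, ∀ (N' : Type) [lang.Structure N'] (f : N ↪ₑ[lang] N'),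
    IsSubgroup (solutions π f) ∧ Cardinal.mk (cosets (solutions π f)) ≤ κ

/-- `G⁰⁰_A(N)`: the intersection of all subgroups of bounded index that are type-definable
over `A`. -/
def bddComponent (A : Set N) : Set N :=
  {x | ∀ π : Set (lang.Formula (A ⊕ Unit)), IsBoundedSubgroup π → x ∈ solutions π (id : N → N)}

end Group

/-- The absolute connected component for definable subgroups of finite index exists:
`G⁰_A` does not depend on the parameter set `A`. -/
def HasAbsoluteFinComponent (T : lang.Theory) : Prop :=
  ∀ (N : Type) [lang.Structure N] [N ⊨ T] (A : Set N), finComponent A = finComponent (∅ : Set N)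

/-- The absolute connected component for type-definable subgroups of bounded index exists:
`G⁰⁰_A` does not depend on the parameter set `A`. -/
def HasAbsoluteBddComponent (T : lang.Theory) : Prop :=
  ∀ (N : Type) [lang.Structure N] [N ⊨ T] (A : Set N), bddComponent A = bddComponent (∅ : Set N)

/-- There is a type-definable subgroup of bounded index (given by a partial type `π` over `A ⊆ N`)
that is minimal: it properly contains no type-definable subgroup of bounded index, over parameters
from any elementary extension. -/
def HasMinimalBddSubgroup (T : lang.Theory) : Prop :=
  ∃ (N : Type) (_ : lang.Structure N) (_ : N ⊨ T) (A : Set N) (π : Set (lang.Formula (A ⊕ Unit))),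
    IsBoundedSubgroup π ∧
    ∀ (N' : Type) [lang.Structure N'] (f : N ↪ₑ[lang] N') (B : Set N')
      (ρ : Set (lang.Formula (B ⊕ Unit))), IsBoundedSubgroup ρ →
      solutions ρ (id : N' → N') ⊆ solutions π f → solutions ρ (id : N' → N') = solutions π f

end BilinearSpace

/-! The standard form is generic: every functional on a finite-dimensional subspace is represented
by a vector outside that subspace, of any prescribed norm (`ExtensionProperty`). Back-and-forth
along finite-dimensional partial isometries then shows that the type of a finite tuple is determined
by its sorts and scalars, its linear relations and its Gram matrix
(`Presentation.realize_formula_iff_of_gram`). As `𝔽_p` is finite, the extension property is a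
first-order scheme, so every model is a space of this kind (`exists_presentation`).

2-dependence is a counting argument. A tuple of fixed length has only exponentially many types over
a finite tuple of parameters, in the length of the latter, while an `n × n` grid with `O(n)`
parameters would need `2 ^ (n * n)` of them.

Simplicity is an amalgamation argument. Along a branch of a tree, an `m`-tuple can acquire new
linear relations at most `m` times. Hence the tree property would give a node with infinitely many
children whose instances have solutions without new relations. A sunflower among the parameters of
these children allows the products prescribed by the solutions to be glued, and a generic vector
tuple with the glued products solves `k` instances at once (`Presentation.exists_common_solution`).

The independence property comes from `y · x₀ = x₁`, with `x₀` an ultraproduct of truncated indicator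
functions.

For the components, intersecting with `b^⊥` multiplies the index by at most `p`, and for every
nonzero `x` some `b^⊥` omits `x`. In a large extension a subgroup of bounded index is nonzero, so it
can always be cut down. Without parameters this cannot happen: nonzero vectors of equal norm have
the same type, so a nonzero invariant subgroup contains every isotropic vector
(`Presentation.isotropic_mem`). -/

namespace BilinearSpace

/-! ### Partial isometries and generic vectors -/

section LinearAlgebra

variable {F U V W : Type*} [Field F] [AddCommGroup U] [Module F U] [AddCommGroup V] [Module F V]
  [AddCommGroup W] [Module F W]

/-- Every functional on a finite-dimensional subspace is represented by a vector outside of it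
whose value under the quadratic form is prescribed. -/
def ExtensionProperty (B : V →ₗ[F] V →ₗ[F] F) : Prop :=
  ∀ D : Submodule F V, D.FG → ∀ (l : V →ₗ[F] F) (c : F),
    ∃ y, y ∉ D ∧ (∀ d ∈ D, B y d = l d) ∧ B y y = c

/-- A finite-dimensional partial isometry between `(U, Q)` and `(V, B)`, given by its graph, which
may kill vectors of `Z` only. -/
structure IsPartialIsometry (Q : U →ₗ[F] U →ₗ[F] F) (B : V →ₗ[F] V →ₗ[F] F) (Z : Submodule F U)
    (S : Submodule F (U × V)) : Prop where
  fg : S.FG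
  isometry : ∀ s ∈ S, ∀ t ∈ S, Q s.1 t.1 = B s.2 t.2
  snd_eq_zero : ∀ s ∈ S, s.1 = 0 → s.2 = 0
  fst_mem : ∀ s ∈ S, s.2 = 0 → s.1 ∈ Z

/-- `g` factors through `U / ker h ≃ range h`, and a linear map on a subspace extends to the whole
space. -/
theorem exists_comp_eq_of_ker_le {g : U →ₗ[F] W} {h : U →ₗ[F] V}
    (hgh : ∀ u, h u = 0 → g u = 0) : ∃ l : V →ₗ[F] W, ∀ u, l (h u) = g u := by
  have hle : LinearMap.ker h ≤ LinearMap.ker g := fun u hu => hgh u hu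
  obtain ⟨l, hl⟩ := LinearMap.exists_extend
    (((LinearMap.ker h).liftQ g hle).comp h.quotKerEquivRange.symm.toLinearMap)
  refine ⟨l, fun u => ?_⟩
  have := LinearMap.congr_fun hl ⟨h u, LinearMap.mem_range_self h u⟩
  simp only [LinearMap.comp_apply, Submodule.subtype_apply] at this
  rw [this]
  have h2 : h.quotKerEquivRange.symm ⟨h u, LinearMap.mem_range_self h u⟩
      = Submodule.Quotient.mk u := by
    rw [LinearEquiv.symm_apply_eq]; rfl
  simp [h2]

/-- Two linear maps that agree on `C ⊓ D` can be glued. -/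
theorem exists_glue (f g : V →ₗ[F] W) (C D : Submodule F V)
    (h : ∀ x ∈ C, x ∈ D → f x = g x) :
    ∃ l : V →ₗ[F] W, (∀ x ∈ C, l x = f x) ∧ ∀ x ∈ D, l x = g x := by
  obtain ⟨l, hl⟩ := exists_comp_eq_of_ker_le (U := C × D)
    (g := (f.comp C.subtype).coprod (g.comp D.subtype)) (h := C.subtype.coprod D.subtype) (by
      rintro ⟨x, y⟩ hxy
      simp only [LinearMap.coprod_apply, Submodule.subtype_apply, LinearMap.comp_apply] at hxy ⊢
      have hx : (x : V) = -(y : V) := eq_neg_of_add_eq_zero_left hxy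
      rw [h x x.2 (by rw [hx]; exact D.neg_mem y.2), hx]
      simp)
  refine ⟨l, fun x hx => ?_, fun x hx => ?_⟩
  · simpa using hl (⟨x, hx⟩, 0)
  · simpa using hl (0, ⟨x, hx⟩)

section PartialIsometry

variable {Q : U →ₗ[F] U →ₗ[F] F} {B : V →ₗ[F] V →ₗ[F] F} {Z : Submodule F U}
  {S : Submodule F (U × V)}

theorem IsPartialIsometry.swap {S : Submodule F (U × V)} (hS : IsPartialIsometry Q B ⊥ S) :
    IsPartialIsometry B Q ⊥ (S.map (LinearEquiv.prodComm F U V).toLinearMap) where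
  fg := hS.fg.map _
  isometry := by
    rintro _ ⟨s, hs, rfl⟩ _ ⟨t, ht, rfl⟩
    exact (hS.isometry s hs t ht).symm
  snd_eq_zero := by
    rintro _ ⟨s, hs, rfl⟩ h
    exact (Submodule.mem_bot F).1 (hS.fst_mem s hs h)
  fst_mem := by
    rintro _ ⟨s, hs, rfl⟩ h
    exact (Submodule.mem_bot F).2 (hS.snd_eq_zero s hs h)

theorem mem_swap {S : Submodule F (U × V)} {u : U} {v : V} :
    (v, u) ∈ S.map (LinearEquiv.prodComm F U V).toLinearMap ↔ (u, v) ∈ S := by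
  constructor
  · rintro ⟨⟨a, b⟩, hs, h⟩
    simp only [LinearEquiv.coe_coe, LinearEquiv.prodComm_apply, Prod.swap_prod_mk,
      Prod.mk.injEq] at h
    obtain ⟨rfl, rfl⟩ := h
    exact hs
  · exact fun h => ⟨(u, v), h, rfl⟩

/-- A partial isometry into a space with the extension property extends to any further vector. -/
theorem IsPartialIsometry.exists_extend_one (hB : ExtensionProperty B)
    (hQs : ∀ u v, Q u v = Q v u) (hBs : ∀ u v, B u v = B v u) (hZ : ∀ z ∈ Z, ∀ u, Q u z = 0)
    (hS : IsPartialIsometry Q B Z S) (x : U) :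
    ∃ S', S ≤ S' ∧ IsPartialIsometry Q B Z S' ∧ ∃ y, (x, y) ∈ S' := by
  by_cases hx : ∃ y, (x, y) ∈ S
  · exact ⟨S, le_rfl, hS, hx⟩
  -- The image `y` of `x` must satisfy `B y s.2 = Q x s.1`. This defines a functional on the second
  -- projection of `S` because the vectors killed by `S` lie in `Z`, hence in the radical of `Q`.
  obtain ⟨l, hl⟩ := exists_comp_eq_of_ker_le (U := S)
    (g := (Q x).comp ((LinearMap.fst F U V).comp S.subtype))
    (h := (LinearMap.snd F U V).comp S.subtype)
    (fun s hs => hZ _ (hS.fst_mem s s.2 hs) x)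
  obtain ⟨y, hyD, hyl, hyy⟩ := hB (S.map (LinearMap.snd F U V)) (hS.fg.map _) l (Q x x)
  have hys : ∀ s ∈ S, B y s.2 = Q x s.1 := fun s hs =>
    (hyl s.2 (Submodule.mem_map_of_mem (f := LinearMap.snd F U V) hs)).trans (hl ⟨s, hs⟩)
  have hxS : ∀ s ∈ S, ∀ c : F, s.1 + c • x = 0 → c = 0 := fun s hs c h => by
    by_contra hc
    refine hx ⟨(-c⁻¹) • s.2, ?_⟩
    have : x = (-c⁻¹) • s.1 := by
      rw [eq_neg_of_add_eq_zero_left h]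
      simp [smul_smul, hc]
    rw [this]
    exact S.smul_mem _ hs
  have hyS : ∀ s ∈ S, ∀ c : F, s.2 + c • y = 0 → c = 0 := fun s hs c h => by
    by_contra hc
    refine hyD ?_
    have : y = (-c⁻¹) • s.2 := by
      rw [eq_neg_of_add_eq_zero_left h]
      simp [smul_smul, hc]
    rw [this]
    exact Submodule.smul_mem _ _ (Submodule.mem_map_of_mem hs)
  refine ⟨S ⊔ Submodule.span F {(x, y)}, le_sup_left, ⟨hS.fg.sup (Submodule.fg_span_singleton _),
    ?_, ?_, ?_⟩, y, Submodule.mem_sup_right (Submodule.mem_span_singleton_self _)⟩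
  · intro s hs₀ t ht₀
    obtain ⟨s, hs, _, hs', rfl⟩ := Submodule.mem_sup.1 hs₀
    obtain ⟨t, ht, _, ht', rfl⟩ := Submodule.mem_sup.1 ht₀
    obtain ⟨c, rfl⟩ := Submodule.mem_span_singleton.1 hs'
    obtain ⟨d, rfl⟩ := Submodule.mem_span_singleton.1 ht'
    have h1 := hS.isometry s hs t ht
    have h2 := hys s hs
    have h3 := hys t ht
    simp only [Prod.fst_add, Prod.snd_add, Prod.smul_fst, Prod.smul_snd, map_add, map_smul,
      LinearMap.add_apply, LinearMap.smul_apply, hQs s.1 x, hBs s.2 y, h1, h2, h3, hyy]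
  · intro s hs₀ h
    obtain ⟨s, hs, _, hs', rfl⟩ := Submodule.mem_sup.1 hs₀
    obtain ⟨c, rfl⟩ := Submodule.mem_span_singleton.1 hs'
    have hc := hxS s hs c h
    subst hc
    simpa using hS.snd_eq_zero s hs (by simpa using h)
  · intro s hs₀ h
    obtain ⟨s, hs, _, hs', rfl⟩ := Submodule.mem_sup.1 hs₀
    obtain ⟨c, rfl⟩ := Submodule.mem_span_singleton.1 hs'
    have hc := hyS s hs c h
    subst hc
    simpa using hS.fst_mem s hs (by simpa using h)

theorem IsPartialIsometry.exists_extend (hB : ExtensionProperty B)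
    (hQs : ∀ u v, Q u v = Q v u) (hBs : ∀ u v, B u v = B v u) (hZ : ∀ z ∈ Z, ∀ u, Q u z = 0)
    (hS : IsPartialIsometry Q B Z S) {ι : Type*} (s : Finset ι) (x : ι → U) :
    ∃ S', S ≤ S' ∧ IsPartialIsometry Q B Z S' ∧ ∀ i ∈ s, ∃ y, (x i, y) ∈ S' := by
  classical
  induction s using Finset.induction_on with
  | empty => exact ⟨S, le_rfl, hS, by simp⟩
  | insert i s _ ih =>
    obtain ⟨S₁, h₁, hS₁, hs₁⟩ := ih
    obtain ⟨S₂, h₂, hS₂, hs₂⟩ := hS₁.exists_extend_one hB hQs hBs hZ (x i)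
    refine ⟨S₂, h₁.trans h₂, hS₂, fun j hj => ?_⟩
    rcases Finset.mem_insert.1 hj with rfl | hj
    · exact hs₂
    · obtain ⟨y, hy⟩ := hs₁ j hj
      exact ⟨y, h₂ hy⟩

/-- Two tuples with the same linear relations and the same Gram matrix are related by a partial
isometry. -/
theorem exists_isPartialIsometry {κ : Type*} [Fintype κ] (v : κ → U) (w : κ → V)
    (hgram : ∀ i j, Q (v i) (v j) = B (w i) (w j))
    (hker : ∀ e : κ → F, ∑ i, e i • v i = 0 ↔ ∑ i, e i • w i = 0) :
    ∃ S, IsPartialIsometry Q B ⊥ S ∧ ∀ i, (v i, w i) ∈ S := by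
  classical
  set u := Fintype.linearCombination F v
  set t := Fintype.linearCombination F w
  refine ⟨LinearMap.range (u.prod t), ⟨Module.Finite.iff_fg.1 inferInstance, ?_, ?_, ?_⟩,
    fun i => ⟨Pi.single i 1, ?_⟩⟩
  · rintro _ ⟨e, rfl⟩ _ ⟨e', rfl⟩
    simp [u, t, Fintype.linearCombination_apply, hgram]
  · rintro _ ⟨e, rfl⟩ h
    simpa [u, t, Fintype.linearCombination_apply] using (hker e).1
      (by simpa [u, t, Fintype.linearCombination_apply] using h)
  · rintro _ ⟨e, rfl⟩ h
    simpa [u, t, Fintype.linearCombination_apply] using (hker e).2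
      (by simpa [u, t, Fintype.linearCombination_apply] using h)
  · simp [u, t]

end PartialIsometry

/-- Given a linear map `u₀` and a finite-dimensional `D`, there is `z` with the same Gram form and
the same values in `A` as `u₀`, otherwise independent of `D`, and with prescribed products
with `D`. -/
theorem exists_generic {E : Type*} [AddCommGroup E] [Module F E] [FiniteDimensional F E]
    {B : V →ₗ[F] V →ₗ[F] F} (hB : ExtensionProperty B) (hBs : ∀ u v, B u v = B v u)
    (u₀ : E →ₗ[F] V) {A D : Submodule F V} (hD : D.FG)
    (l : V →ₗ[F] E →ₗ[F] F) (hl : ∀ d ∈ D, ∀ e, u₀ e ∈ A → l d e = B (u₀ e) d)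
    (hlA : ∀ d ∈ A, ∀ e, l d e = B (u₀ e) d) :
    ∃ z : E →ₗ[F] V, (∀ e, u₀ e ∈ A → z e = u₀ e) ∧ (∀ e, z e ∈ D → u₀ e ∈ A) ∧
      (∀ e, ∀ d ∈ D, B (z e) d = l d e) ∧ ∀ e e', B (z e) (z e') = B (u₀ e) (u₀ e') := by
  classical
  let R : Submodule F E := A.comap u₀
  let ft := LinearMap.fst F D E
  let sd := LinearMap.snd F D E
  let lD : D →ₗ[F] E →ₗ[F] F := l.comp D.subtype
  -- `D × E` carries the form that the desired configuration would have: `B` on `D`, the Gram form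
  -- of `u₀` on `E`, and the prescribed products `l` between them. It remains to map it to `V`
  -- isometrically over `D`.
  let Q : (D × E) →ₗ[F] (D × E) →ₗ[F] F :=
    B.compl₁₂ (D.subtype.comp ft) (D.subtype.comp ft) + lD.compl₁₂ ft sd
      + (lD.compl₁₂ ft sd).flip + B.compl₁₂ (u₀.comp sd) (u₀.comp sd)
  have hQ : ∀ d e d' e', Q (d, e) (d', e') =
      B d d' + l d e' + l d' e + B (u₀ e) (u₀ e') := fun d e d' e' => rfl
  have hQs : ∀ x y, Q x y = Q y x := by
    rintro ⟨d, e⟩ ⟨d', e'⟩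
    rw [hQ, hQ, hBs d d', hBs (u₀ e)]; ring
  -- The only identifications wanted between `D` and `E` are those forced by `z = u₀` over `A`. The
  -- hypotheses on `l` say that these lie in the radical of `Q`.
  let Z : Submodule F (D × E) := R.comap sd ⊓ LinearMap.ker (D.subtype.comp ft + u₀.comp sd)
  have hZ : ∀ z ∈ Z, ∀ x, Q x z = 0 := by
    rintro ⟨d', e'⟩ ⟨hz, hz'⟩ ⟨d, e⟩
    have hz : u₀ e' ∈ A := hz
    have hz' : (d' : V) = - u₀ e' := eq_neg_of_add_eq_zero_left hz'
    rw [hQ, hz', hl d d.2 e' hz, map_neg, map_neg, LinearMap.neg_apply, hlA _ hz, hBs d, hBs (u₀ e)]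
    ring
  let φ : (D × R) →ₗ[F] (D × E) × V :=
    (LinearMap.prodMap LinearMap.id R.subtype).prod (D.subtype.coprod (u₀.comp R.subtype))
  have hφ : ∀ d e, φ (d, e) = ((d, (e : E)), (d : V) + u₀ e) := fun d e => rfl
  have : FiniteDimensional F D := Module.Finite.iff_fg.2 hD
  have hS₀ : IsPartialIsometry Q B Z (LinearMap.range φ) := by
    refine ⟨Module.Finite.iff_fg.1 inferInstance, ?_, ?_, ?_⟩
    · rintro _ ⟨⟨d, e⟩, rfl⟩ _ ⟨⟨d', e'⟩, rfl⟩
      simp only [hφ, hQ, map_add, LinearMap.add_apply]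
      rw [hl d d.2 e' e'.2, hl d' d'.2 e e.2, hBs d (u₀ e')]
      ring
    · rintro _ ⟨⟨d, e⟩, rfl⟩ h
      simp only [hφ, Prod.mk_eq_zero] at h ⊢
      simp [h.1, h.2]
    · rintro _ ⟨⟨d, e⟩, rfl⟩ h
      exact ⟨e.2, h⟩
  let b := Module.finBasis F E
  obtain ⟨S, hS₀S, hS, hSb⟩ := hS₀.exists_extend hB hQs hBs hZ Finset.univ
    (fun i => ((0, b i) : D × E))
  choose y hy using fun i => hSb i (Finset.mem_univ i)
  let z := b.constr F y
  have hz : ∀ e, (((0 : D), e), z e) ∈ S := by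
    intro e
    have h1 : (((0 : D), e), z e) = ∑ i, b.repr e i • (((0 : D), b i), y i) := by
      ext1
      · ext1
        · simp [Prod.fst_sum]
        · simp [Prod.fst_sum, Prod.snd_sum, b.sum_repr]
      · simp [Prod.snd_sum, z, Module.Basis.constr_apply_fintype]
    rw [h1]
    exact S.sum_mem fun i _ => S.smul_mem _ (hy i)
  have hd : ∀ d : D, ((d, (0 : E)), (d : V)) ∈ S := fun d =>
    hS₀S ⟨(d, 0), by simp [hφ]⟩
  refine ⟨z, fun e he => ?_, fun e he => ?_, fun e d hdD => ?_, fun e e' => ?_⟩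
  · have h1 : (((0 : D), e), u₀ e) ∈ S := hS₀S ⟨(0, ⟨e, he⟩), by simp [hφ]⟩
    exact sub_eq_zero.1 (hS.snd_eq_zero _ (S.sub_mem (hz e) h1) (by simp))
  -- If `z e` lies in `D`, then `(0, e) - (z e, 0)` is mapped to zero, so it belongs to `Z`.
  · have h1 := hS.fst_mem _ (S.sub_mem (hz e) (hd (Subtype.mk (z e) he))) (sub_self (z e))
    have h2 : e - 0 ∈ R := h1.1
    rwa [sub_zero] at h2
  · simpa [hQ] using (hS.isometry _ (hz e) _ (hd ⟨d, hdD⟩)).symm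
  · simpa [hQ] using (hS.isometry _ (hz e) _ (hz e')).symm

end LinearAlgebra

/-! ### Sunflowers over a finite field -/

section Finiteness

variable {F V W : Type*} [Field F] [AddCommGroup V] [Module F V]
  [AddCommGroup W] [Module F W]

theorem finite_of_fg [Finite F] {D : Submodule F V} (hD : D.FG) : Finite D :=
  have : Module.Finite F D := Module.Finite.iff_fg.2 hD
  Module.finite_of_finite F

/-- An infinite set of natural numbers contains an infinite set on which a given function with
finitely many values is constant. -/
theorem exists_infinite_subset_const {β : Type*} [Finite β] {I : Set ℕ} (hI : I.Infinite)
    (f : ℕ → β) : ∃ J ⊆ I, J.Infinite ∧ ∃ b, ∀ i ∈ J, f i = b := by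
  by_contra! h
  have hfin : (⋃ b, {i ∈ I | f i = b}).Finite := Set.finite_iUnion fun b => ?_
  · exact hI (hfin.subset fun i hi => Set.mem_iUnion.2 ⟨f i, hi, rfl⟩)
  by_contra hb
  obtain ⟨i, hi, hi'⟩ := h {i ∈ I | f i = b} (fun i hi => hi.1) hb b
  exact hi' hi.2

/-- A sunflower lemma: among infinitely many finite-dimensional subspaces given by tuples of the
same length there are infinitely many whose intersections with any finite-dimensional subspace are
almost always contained in a fixed finite-dimensional kernel. -/
theorem exists_sunflower [Finite F] {E : Type*} [AddCommGroup E] [Module F E] [Finite E]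
    {I : Set ℕ} (hI : I.Infinite) (w : ℕ → E →ₗ[F] V) :
    ∃ J ⊆ I, J.Infinite ∧ ∃ A : Submodule F V, A.FG ∧
      ∀ D : Submodule F V, D.FG → {i ∈ J | ¬ LinearMap.range (w i) ⊓ D ≤ A}.Finite := by
  classical
  -- `c J` counts the coordinate vectors whose image is the same for all members of `J`. An infinite
  -- `J` that maximizes it is a sunflower.
  let c : Set ℕ → ℕ := fun J => {e : E | ∃ v, ∀ i ∈ J, w i e = v}.ncard
  have hbdd : ∀ J, c J ≤ Nat.card E := fun J => Set.ncard_le_card _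
  let P : ℕ → Prop := fun n => ∃ J ⊆ I, J.Infinite ∧ c J = n
  have hP : ∃ n, P n := ⟨c I, I, subset_rfl, hI, rfl⟩
  obtain ⟨n₀, hn₀⟩ := hP
  have hle : n₀ ≤ Nat.card E := by obtain ⟨J, -, -, rfl⟩ := hn₀; exact hbdd J
  obtain ⟨J, hJI, hJ, hcJ⟩ := Nat.findGreatest_spec (P := P) hle hn₀
  have hmax : ∀ J' ⊆ I, J'.Infinite → c J' ≤ c J := fun J' h h' => by
    rw [hcJ]
    exact Nat.le_findGreatest (hbdd J') ⟨J', h, h', rfl⟩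
  obtain ⟨j₀, hj₀⟩ := hJ.nonempty
  refine ⟨J, hJI, hJ, Submodule.span F (Set.range (w j₀)), Submodule.fg_span (Set.finite_range _),
    fun D hD => ?_⟩
  by_contra hinf
  have := finite_of_fg hD
  have hchoose : ∀ i, ∃ ed : E × D, i ∈ {i ∈ J | ¬ LinearMap.range (w i) ⊓ D ≤
      Submodule.span F (Set.range (w j₀))} →
      w i ed.1 = ed.2 ∧ (ed.2 : V) ∉ Submodule.span F (Set.range (w j₀)) := by
    intro i
    by_cases hi : ¬ LinearMap.range (w i) ⊓ D ≤ Submodule.span F (Set.range (w j₀))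
    · obtain ⟨v, ⟨⟨e, rfl⟩, hvD⟩, hv⟩ := SetLike.not_le_iff_exists.1 hi
      exact ⟨(e, ⟨_, hvD⟩), fun _ => ⟨rfl, hv⟩⟩
    · exact ⟨0, fun h => absurd h.2 hi⟩
  choose f hf using hchoose
  obtain ⟨J', hJ'J, hJ', ⟨e, d⟩, hed⟩ := exists_infinite_subset_const hinf f
  -- On `J'` the image of `e` is constantly `d`. On `J` it is not constant, since `d` lies outside
  -- the range of `w j₀`. So `J'` would beat the maximum.
  have hlt : c J < c J' := by
    refine Set.ncard_lt_ncard ?_ (Set.toFinite _)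
    refine ⟨fun e ⟨v, hv⟩ => ⟨v, fun i hi => hv i (hJ'J hi).1⟩, fun hsub => ?_⟩
    have he : e ∈ {e : E | ∃ v, ∀ i ∈ J', w i e = v} :=
      ⟨d, fun i hi => by have := (hf i (hJ'J hi)).1; rwa [hed i hi] at this⟩
    obtain ⟨v, hv⟩ := hsub he
    obtain ⟨i, hi⟩ := hJ'.nonempty
    have h1 := hf i (hJ'J hi)
    rw [hed i hi] at h1
    refine h1.2 ?_
    rw [← h1.1]
    have : w i e = w j₀ e := (hv i (hJ'J hi).1).trans (hv j₀ hj₀).symm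
    rw [this]
    exact Submodule.subset_span ⟨e, rfl⟩
  exact absurd (hmax J' (fun i hi => hJI (hJ'J hi).1) hJ') (not_le.2 hlt)

/-- Functionals on the members of a sunflower that agree on the kernel can be glued on any number of
members. -/
theorem exists_glue_sunflower {E : Type*} [AddCommGroup E] [Module F E] [Finite E]
    {J : Set ℕ} (hJ : J.Infinite) (w : ℕ → E →ₗ[F] V) {A : Submodule F V} (hA : A.FG)
    (hw : ∀ D : Submodule F V, D.FG → {i ∈ J | ¬ LinearMap.range (w i) ⊓ D ≤ A}.Finite)
    (f : ℕ → V →ₗ[F] W) (hf : ∀ i ∈ J, ∀ j ∈ J, ∀ x ∈ A, f i x = f j x) (k : ℕ) :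
    ∃ (s : Finset ℕ) (l : V →ₗ[F] W), s.card = k ∧ ↑s ⊆ J ∧ (∀ i ∈ J, ∀ x ∈ A, l x = f i x) ∧
      ∀ i ∈ s, ∀ e, l (w i e) = f i (w i e) := by
  classical
  induction k with
  | zero =>
    obtain ⟨j, hj⟩ := hJ.nonempty
    exact ⟨∅, f j, rfl, by simp, fun i hi x hx => hf j hj i hi x hx, by simp⟩
  | succ k ih =>
    obtain ⟨s, l, hs, hsJ, hlA, hl⟩ := ih
    set D : Submodule F V := A ⊔ ⨆ i ∈ s, LinearMap.range (w i) with hDdef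
    have hD : D.FG := hA.sup (Submodule.fg_biSup s _ fun i _ =>
      Module.Finite.iff_fg.1 inferInstance)
    -- All but finitely many members meet the span of the previous choices inside the kernel `A`
    -- only, where the functionals agree.
    obtain ⟨i, hi⟩ := (hJ.sdiff ((hw D hD).union s.finite_toSet)).nonempty
    simp only [Set.mem_sdiff, Set.mem_union, Set.mem_ofPred_eq, not_or, not_and, not_not,
      Finset.mem_coe] at hi
    obtain ⟨hiJ, hiD, his⟩ := hi
    obtain ⟨l', hl'D, hl'i⟩ := exists_glue l (f i) D (LinearMap.range (w i))
      (fun x hxD hxi => hlA i hiJ x (hiD hiJ ⟨hxi, hxD⟩))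
    refine ⟨insert i s, l', by rw [Finset.card_insert_of_notMem his, hs], ?_, ?_, ?_⟩
    · rw [Finset.coe_insert]
      exact Set.insert_subset hiJ hsJ
    · intro j hj x hx
      rw [hl'D x (Submodule.mem_sup_left hx), hlA j hj x hx]
    · intro j hj e
      rcases Finset.mem_insert.1 hj with rfl | hj
      · exact hl'i _ ⟨e, rfl⟩
      · rw [hl'D _ (Submodule.mem_sup_right ?_), hl j hj]
        exact Submodule.mem_iSup_of_mem j (Submodule.mem_iSup_of_mem hj ⟨e, rfl⟩)

end Finiteness

/-! ### Presentations and invariance of formulas under partial isometries -/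

open FirstOrder.Language

/-- A presentation of the structure `K` as the disjoint union of the vector space `V` and the
prime field, with the bilinear form `B`. -/
structure Presentation (p : ℕ) (V : Type*) [AddCommGroup V] [Module (ZMod p) V]
    (B : V →ₗ[ZMod p] V →ₗ[ZMod p] ZMod p) (K : Type*) [lang.Structure K] where
  vec : V → K
  scal : ZMod p → K
  vec_injective : Function.Injective vec
  scal_injective : Function.Injective scal
  vec_ne_scal : ∀ x c, vec x ≠ scal c
  vec_or_scal : ∀ k, (∃ x, k = vec x) ∨ ∃ c, k = scal c
  zero : ∀ t, Structure.funMap (L := lang) Func.zero t = vec 0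
  rel_vec : ∀ t, Structure.RelMap (L := lang) Rel.vec t ↔ ∃ x, t 0 = vec x
  rel_scal : ∀ t, Structure.RelMap (L := lang) Rel.scal t ↔ ∃ c, t 0 = scal c
  rel_add : ∀ t, Structure.RelMap (L := lang) Rel.add t ↔
    ∃ x y, t 0 = vec x ∧ t 1 = vec y ∧ t 2 = vec (x + y)
  rel_dot : ∀ t, Structure.RelMap (L := lang) Rel.dot t ↔
    ∃ x y, t 0 = vec x ∧ t 1 = vec y ∧ t 2 = scal (B x y)
  symm : ∀ x y, B x y = B y x

namespace Presentation

variable {p : ℕ} {V : Type*} [AddCommGroup V] [Module (ZMod p) V]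
  {B : V →ₗ[ZMod p] V →ₗ[ZMod p] ZMod p} {K : Type*} [lang.Structure K]
  {W : Type*} [AddCommGroup W] [Module (ZMod p) W]
  {C : W →ₗ[ZMod p] W →ₗ[ZMod p] ZMod p} {K' : Type*} [lang.Structure K']

/-- The relation between elements induced by a relation between vectors. -/
def Related (P : Presentation p V B K) (P' : Presentation p W C K')
    (S : Submodule (ZMod p) (V × W)) (k : K) (k' : K') : Prop :=
  (∃ x y, k = P.vec x ∧ k' = P'.vec y ∧ (x, y) ∈ S) ∨ ∃ c, k = P.scal c ∧ k' = P'.scal c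

variable {P : Presentation p V B K} {P' : Presentation p W C K'}
  {S : Submodule (ZMod p) (V × W)}

theorem Related.mono {S' : Submodule (ZMod p) (V × W)} (h : S ≤ S') {k : K} {k' : K'}
    (hk : Related P P' S k k') : Related P P' S' k k' := by
  rcases hk with ⟨x, y, hx, hy, hxy⟩ | hc
  · exact Or.inl ⟨x, y, hx, hy, h hxy⟩
  · exact Or.inr hc

theorem Related.swap [Fact p.Prime] {k : K} {k' : K'} (hk : Related P P' S k k') :
    Related P' P (S.map (LinearEquiv.prodComm (ZMod p) V W).toLinearMap) k' k := by
  rcases hk with ⟨x, y, hx, hy, hxy⟩ | ⟨c, hc, hc'⟩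
  · exact Or.inl ⟨y, x, hy, hx, mem_swap.2 hxy⟩
  · exact Or.inr ⟨c, hc', hc⟩

@[simp] theorem scal_ne_vec (P : Presentation p V B K) (c : ZMod p) (x : V) :
    P.scal c ≠ P.vec x := (P.vec_ne_scal x c).symm

@[simp] theorem vec_inj (P : Presentation p V B K) {x y : V} : P.vec x = P.vec y ↔ x = y :=
  P.vec_injective.eq_iff

@[simp] theorem scal_inj (P : Presentation p V B K) {c d : ZMod p} :
    P.scal c = P.scal d ↔ c = d := P.scal_injective.eq_iff

attribute [simp] vec_ne_scal

/-- `S` is the graph of a function: two images of one vector differ by some `y` with `(0, y) ∈ S`.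
Together with `IsPartialIsometry.swap` this settles atomic equalities. -/
theorem Related.unique [Fact p.Prime] (hS : IsPartialIsometry B C ⊥ S) {k l : K} {k' l' : K'}
    (hk : Related P P' S k k') (hl : Related P P' S l l') (h : k = l) : k' = l' := by
  subst h
  rcases hk with ⟨x, y, rfl, rfl, hxy⟩ | ⟨c, rfl, rfl⟩ <;>
    rcases hl with ⟨x', y', h, rfl, hxy'⟩ | ⟨c', h, rfl⟩ <;> simp at h
  · subst h
    have := hS.snd_eq_zero _ (S.sub_mem hxy hxy') (by simp)
    exact congrArg P'.vec (sub_eq_zero.1 this)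
  · rw [h]

theorem Related.relMap [Fact p.Prime] (hS : IsPartialIsometry B C ⊥ S) {n : ℕ} (r : lang.Relations n)
    {t : Fin n → K} {t' : Fin n → K'} (h : ∀ i, Related P P' S (t i) (t' i))
    (ht : Structure.RelMap r t) : Structure.RelMap r t' := by
  rcases r with _ | _ | _ | _
  · rw [P.rel_vec] at ht
    rw [P'.rel_vec]
    obtain ⟨x, hx⟩ := ht
    rcases h 0 with ⟨_, y, _, hy, _⟩ | ⟨c, hc, _⟩
    · exact ⟨y, hy⟩
    · simp [hx] at hc
  · rw [P.rel_scal] at ht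
    rw [P'.rel_scal]
    obtain ⟨x, hx⟩ := ht
    rcases h 0 with ⟨_, y, hy, _⟩ | ⟨c, _, hc⟩
    · simp [hx] at hy
    · exact ⟨c, hc⟩
  · rw [P.rel_add] at ht
    rw [P'.rel_add]
    obtain ⟨x, y, hx, hy, hz⟩ := ht
    rcases h 0 with ⟨x₁, x', h1, hx', hxS⟩ | ⟨c, hc, _⟩
    swap; · simp [hx] at hc
    rcases h 1 with ⟨y₁, y', h2, hy', hyS⟩ | ⟨c, hc, _⟩
    swap; · simp [hy] at hc
    rw [hx, vec_inj] at h1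
    rw [hy, vec_inj] at h2
    subst h1 h2
    exact ⟨x', y', hx', hy', (h 2).unique hS (Or.inl ⟨_, _, rfl, rfl, S.add_mem hxS hyS⟩) hz⟩
  · rw [P.rel_dot] at ht
    rw [P'.rel_dot]
    obtain ⟨x, y, hx, hy, hz⟩ := ht
    rcases h 0 with ⟨x₁, x', h1, hx', hxS⟩ | ⟨c, hc, _⟩
    swap; · simp [hx] at hc
    rcases h 1 with ⟨y₁, y', h2, hy', hyS⟩ | ⟨c, hc, _⟩
    swap; · simp [hy] at hc
    rw [hx, vec_inj] at h1
    rw [hy, vec_inj] at h2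
    subst h1 h2
    refine ⟨x', y', hx', hy', (h 2).unique hS (Or.inr ⟨B x y, rfl, ?_⟩) hz⟩
    rw [hS.isometry _ hxS _ hyS]

theorem Related.realize_term {α : Type*} (t : lang.Term α) {v : α → K} {v' : α → K'}
    (h : ∀ i, Related P P' S (v i) (v' i)) : Related P P' S (t.realize v) (t.realize v') := by
  induction t with
  | var i => exact h i
  | func f ts _ =>
    cases f
    exact Or.inl ⟨0, 0, P.zero _, P'.zero _, S.zero_mem⟩

theorem exists_related [Fact p.Prime] (hC : ExtensionProperty C)
    (hS : IsPartialIsometry B C ⊥ S) (k : K) :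
    ∃ S', S ≤ S' ∧ IsPartialIsometry B C ⊥ S' ∧ ∃ k', Related P P' S' k k' := by
  rcases P.vec_or_scal k with ⟨x, rfl⟩ | ⟨c, rfl⟩
  · obtain ⟨S', h, hS', y, hy⟩ := hS.exists_extend_one hC P.symm P'.symm (by simp) x
    exact ⟨S', h, hS', _, Or.inl ⟨x, y, rfl, rfl, hy⟩⟩
  · exact ⟨S, le_rfl, hS, _, Or.inr ⟨c, rfl, rfl⟩⟩

/-- Formulas are invariant under partial isometries. -/
theorem realize_boundedFormula_iff [Fact p.Prime] (hB : ExtensionProperty B)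
    (hC : ExtensionProperty C) {α : Type*} {n : ℕ} (φ : lang.BoundedFormula α n)
    {v : α → K} {xs : Fin n → K} {v' : α → K'} {xs' : Fin n → K'}
    {S : Submodule (ZMod p) (V × W)} (hS : IsPartialIsometry B C ⊥ S)
    (hv : ∀ i, Related P P' S (v i) (v' i)) (hxs : ∀ i, Related P P' S (xs i) (xs' i)) :
    φ.Realize v xs ↔ φ.Realize v' xs' := by
  induction φ generalizing S with
  | falsum => rfl
  | equal t₁ t₂ =>
    have h : ∀ i, Related P P' S (Sum.elim v xs i) (Sum.elim v' xs' i) := by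
      rintro (i | i)
      exacts [hv i, hxs i]
    have h1 := Related.realize_term t₁ h
    have h2 := Related.realize_term t₂ h
    exact ⟨fun he => h1.unique hS h2 he, fun he => h1.swap.unique hS.swap h2.swap he⟩
  | rel R ts =>
    have h : ∀ i, Related P P' S (Sum.elim v xs i) (Sum.elim v' xs' i) := by
      rintro (i | i)
      exacts [hv i, hxs i]
    have h1 := fun i => Related.realize_term (ts i) h
    exact ⟨fun he => Related.relMap hS R h1 he,
      fun he => Related.relMap hS.swap R (fun i => (h1 i).swap) he⟩
  | imp φ₁ φ₂ ih₁ ih₂ =>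
    rw [BoundedFormula.realize_imp, BoundedFormula.realize_imp, ih₁ hS hv hxs, ih₂ hS hv hxs]
  | all φ ih =>
    rw [BoundedFormula.realize_all, BoundedFormula.realize_all]
    have hsnoc : ∀ {S' : Submodule (ZMod p) (V × W)}, S ≤ S' → ∀ {k k'}, Related P P' S' k k' →
        ∀ i, Related P P' S' (Fin.snoc (α := fun _ => K) xs k i)
          (Fin.snoc (α := fun _ => K') xs' k' i) := by
      intro S' h k k' hk i
      refine Fin.lastCases ?_ (fun i => ?_) i
      · simpa using hk
      · simpa using (hxs i).mono h
    -- Back and forth: a witness on either side is added to the partial isometry by the extension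
    -- property of the other side.
    constructor
    · intro h k'
      obtain ⟨S', hle, hS', k, hk⟩ := exists_related (P := P') (P' := P) hB hS.swap k'
      have hle' : S ≤ S'.map (LinearEquiv.prodComm (ZMod p) W V).toLinearMap :=
        fun s hs => mem_swap.2 (hle (mem_swap.2 hs))
      exact (ih hS'.swap (fun i => (hv i).mono hle') (hsnoc hle' hk.swap)).1 (h k)
    · intro h k
      obtain ⟨S', hle, hS', k', hk⟩ := exists_related (P := P) (P' := P') hC hS k
      exact (ih hS' (fun i => (hv i).mono hle) (hsnoc hle hk)).2 (h k')

theorem realize_formula_iff [Fact p.Prime] (hB : ExtensionProperty B)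
    (hC : ExtensionProperty C) {α : Type*} (φ : lang.Formula α)
    {v : α → K} {v' : α → K'} (hS : IsPartialIsometry B C ⊥ S)
    (hv : ∀ i, Related P P' S (v i) (v' i)) : φ.Realize v ↔ φ.Realize v' :=
  realize_boundedFormula_iff hB hC φ hS hv finZeroElim

open Classical in
/-- The vector `x` if `k` is the vector `x`, and `0` if `k` is a scalar. -/
noncomputable def vecPart (P : Presentation p V B K) (k : K) : V :=
  if h : ∃ x, k = P.vec x then h.choose else 0

open Classical in
/-- The scalar `c` if `k` is the scalar `c`, and `none` if `k` is a vector. -/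
noncomputable def scalPart (P : Presentation p V B K) (k : K) : Option (ZMod p) :=
  if h : ∃ c, k = P.scal c then some h.choose else none

@[simp] theorem vecPart_vec (P : Presentation p V B K) (x : V) : P.vecPart (P.vec x) = x := by
  have h : ∃ y, P.vec x = P.vec y := ⟨x, rfl⟩
  rw [vecPart, dif_pos h]
  exact (P.vec_injective h.choose_spec).symm

@[simp] theorem scalPart_vec (P : Presentation p V B K) (x : V) : P.scalPart (P.vec x) = none := by
  simp [scalPart]

@[simp] theorem scalPart_scal (P : Presentation p V B K) (c : ZMod p) :
    P.scalPart (P.scal c) = some c := by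
  have h : ∃ d, P.scal c = P.scal d := ⟨c, rfl⟩
  rw [scalPart, dif_pos h]
  exact congrArg some (P.scal_injective h.choose_spec).symm

theorem related_of_parts {k : K} {k' : K'} (hs : P.scalPart k = P'.scalPart k')
    (hv : (P.vecPart k, P'.vecPart k') ∈ S) : Related P P' S k k' := by
  rcases P.vec_or_scal k with ⟨x, rfl⟩ | ⟨c, rfl⟩ <;>
    rcases P'.vec_or_scal k' with ⟨y, rfl⟩ | ⟨d, rfl⟩ <;> simp at hs hv
  · exact Or.inl ⟨x, y, rfl, rfl, hv⟩
  · subst hs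
    exact Or.inr ⟨c, rfl, rfl⟩

/-- Tuples with the same scalars, the same linear relations and the same Gram matrix satisfy the
same formulas. -/
theorem realize_formula_iff_of_gram [Fact p.Prime] (hB : ExtensionProperty B)
    (hC : ExtensionProperty C) {α : Type*} [Fintype α] (φ : lang.Formula α)
    {v : α → K} {v' : α → K'} (hs : ∀ i, P.scalPart (v i) = P'.scalPart (v' i))
    (hgram : ∀ i j, B (P.vecPart (v i)) (P.vecPart (v j))
      = C (P'.vecPart (v' i)) (P'.vecPart (v' j)))
    (hker : ∀ e : α → ZMod p, ∑ i, e i • P.vecPart (v i) = 0 ↔ ∑ i, e i • P'.vecPart (v' i) = 0) :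
    φ.Realize v ↔ φ.Realize v' := by
  obtain ⟨S, hS, hv⟩ := exists_isPartialIsometry _ _ hgram hker
  exact realize_formula_iff hB hC φ hS fun i => related_of_parts (hs i) (hv i)

end Presentation

/-! ### Criteria for the extension property -/

section ExtensionProperty

variable {F V : Type*} [Field F] [AddCommGroup V] [Module F V]

/-- If no nonzero vector is orthogonal to all others, then functionals on finite-dimensional
subspaces are represented by vectors. -/
theorem exists_represents {B : V →ₗ[F] V →ₗ[F] F} (hB : ∀ d, (∀ x, B x d = 0) → d = 0)
    {D : Submodule F V} (hD : D.FG) (l : V →ₗ[F] F) : ∃ x, ∀ d ∈ D, B x d = l d := by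
  have : FiniteDimensional F D := Module.Finite.iff_fg.2 hD
  -- The functionals on `D` represented by vectors have no common zero but `0`, so by
  -- finite-dimensional duality they are all functionals.
  let Φ : V →ₗ[F] Module.Dual F D := (Module.Dual.transpose D.subtype).comp B
  have h1 : (LinearMap.range Φ).dualCoannihilator = ⊥ := by
    refine (Submodule.eq_bot_iff _).2 fun d hd => ?_
    rw [Submodule.mem_dualCoannihilator] at hd
    exact Subtype.ext (hB d fun x => hd _ ⟨x, rfl⟩)
  have h2 : LinearMap.range Φ = ⊤ := by
    rw [← Subspace.dualCoannihilator_dualAnnihilator_eq (W := LinearMap.range Φ), h1,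
      Submodule.dualAnnihilator_bot]
  obtain ⟨x, hx⟩ := LinearMap.range_eq_top.1 h2 (l.comp D.subtype)
  exact ⟨x, fun d hd => LinearMap.congr_fun hx ⟨d, hd⟩⟩

/-- A finite-dimensional subspace is a finite set and can be listed as the family `b`, and the
functional is represented by some `x`. In this form the extension property is a scheme of
first-order sentences. -/
theorem extensionProperty_of_finite_families [Finite F] {B : V →ₗ[F] V →ₗ[F] F}
    (hB : ∀ d, (∀ x, B x d = 0) → d = 0)
    (h : ∀ (n : ℕ) (b : Fin n → V) (x : V) (c : F),
      ∃ y, (∀ i, y ≠ b i ∧ B y (b i) = B x (b i)) ∧ B y y = c) : ExtensionProperty B := by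
  intro D hD l c
  have := finite_of_fg hD
  obtain ⟨x, hx⟩ := exists_represents hB hD l
  let e := (Finite.equivFin D).symm
  obtain ⟨y, hy, hyy⟩ := h _ (fun i => (e i : V)) x c
  have hy' : ∀ d : D, y ≠ d ∧ B y d = B x d := fun d => by simpa using hy (e.symm d)
  exact ⟨y, fun hyD => (hy' ⟨y, hyD⟩).1 rfl, fun d hd => ((hy' ⟨d, hd⟩).2).trans (hx d hd), hyy⟩

theorem ExtensionProperty.nondegenerate {B : V →ₗ[F] V →ₗ[F] F} (hB : ExtensionProperty B) {d : V}
    (hd : d ≠ 0) : ∃ x, B x d ≠ 0 := by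
  obtain ⟨f, hf⟩ := Module.Projective.exists_dual_ne_zero F hd
  obtain ⟨y, -, hy, -⟩ := hB (F ∙ d) (Submodule.fg_span_singleton d) f 0
  exact ⟨y, by rwa [hy d (Submodule.mem_span_singleton_self d)]⟩

end ExtensionProperty

/-! ### The standard model -/

section Standard

variable {p : ℕ}

theorem form_eq_sum_of_subset (x y : ℕ →₀ ZMod p) {s : Finset ℕ} (hs : x.support ⊆ s) :
    form x y = ∑ i ∈ s, x i * y i :=
  Finset.sum_subset hs fun i _ hi => by simp [Finsupp.notMem_support_iff.1 hi]

theorem form_comm (x y : ℕ →₀ ZMod p) : form x y = form y x := by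
  rw [form_eq_sum_of_subset x y (s := x.support ∪ y.support) Finset.subset_union_left,
    form_eq_sum_of_subset y x (s := x.support ∪ y.support) Finset.subset_union_right]
  exact Finset.sum_congr rfl fun i _ => mul_comm _ _

/-- The bilinear form of `BilinearSpace.form` as a bilinear map. -/
noncomputable def bilinForm (p : ℕ) : (ℕ →₀ ZMod p) →ₗ[ZMod p] (ℕ →₀ ZMod p) →ₗ[ZMod p] ZMod p :=
  have hadd (x y z : ℕ →₀ ZMod p) : form x (y + z) = form x y + form x z := by
    simp [form, mul_add, Finset.sum_add_distrib]
  have hsmul (c : ZMod p) (x y : ℕ →₀ ZMod p) : form x (c • y) = c • form x y := by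
    simp [form, Finset.mul_sum, mul_left_comm]
  LinearMap.mk₂ (ZMod p) form (fun x y z => by simp only [form_comm _ z, hadd])
    (fun c x y => by simp only [form_comm _ y, hsmul]) hadd hsmul

@[simp] theorem bilinForm_apply (x y : ℕ →₀ ZMod p) : bilinForm p x y = form x y := rfl

theorem form_single (x : ℕ →₀ ZMod p) (i : ℕ) (c : ZMod p) :
    form (Finsupp.single i c) x = c * x i := by
  rw [form_eq_sum_of_subset _ _ Finsupp.support_single_subset]
  simp

theorem bilinForm_extensionProperty [Fact p.Prime] : ExtensionProperty (bilinForm p) := by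
  refine extensionProperty_of_finite_families (fun d hd => ?_) fun n b x c => ?_
  · ext i
    simpa [form_single] using hd (Finsupp.single i 1)
  obtain ⟨N, hN⟩ : ∃ N, ∀ m, N ≤ m → x m = 0 ∧ ∀ i, b i m = 0 := by
    obtain ⟨N, hN⟩ := (x.support ∪ Finset.univ.biUnion fun i => (b i).support).exists_nat_subset_range
    refine ⟨N, fun m hm => ⟨?_, fun i => ?_⟩⟩
    · by_contra h
      have := hN (Finset.mem_union_left _ (Finsupp.mem_support_iff.2 h))
      simp at this
      omega
    · by_contra h
      have := hN (Finset.mem_union_right _ (Finset.mem_biUnion.2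
        ⟨i, Finset.mem_univ i, Finsupp.mem_support_iff.2 h⟩))
      simp at this
      omega
  -- Adding `r` ones beyond all supports changes the norm by `r = c - form x x` modulo `p` and
  -- leaves the products with the `b i` alone. The summand `p` makes `r` positive, so that the new
  -- vector differs from every `b i`.
  let r := (c - form x x).val + p
  have hp := (Fact.out : p.Prime).pos
  let z : ℕ →₀ ZMod p := Finsupp.indicator (Finset.Ico N (N + r)) fun _ _ => 1
  have hz : ∀ i, z i = if i ∈ Finset.Ico N (N + r) then 1 else 0 := fun i => by
    simp [z, Finsupp.indicator_apply]
  have hzs : ∀ y, form z y = ∑ i ∈ Finset.Ico N (N + r), y i := fun y => by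
    rw [form_eq_sum_of_subset z y (Finsupp.support_indicator_subset _ _)]
    exact Finset.sum_congr rfl fun i hi => by rw [hz, if_pos hi, one_mul]
  have hz0 : ∀ y : ℕ →₀ ZMod p, (∀ m, N ≤ m → y m = 0) → form z y = 0 := fun y hy => by
    rw [hzs]
    exact Finset.sum_eq_zero fun i hi => hy i (Finset.mem_Ico.1 hi).1
  have hzz : form z z = c - form x x := by
    rw [hzs, Finset.sum_congr rfl fun i hi => (hz i).trans (if_pos hi)]
    simp [r]
  have hzx : form z x = 0 := hz0 x fun m hm => (hN m hm).1
  refine ⟨x + z, fun i => ⟨fun h => ?_, ?_⟩, ?_⟩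
  · have h1 := DFunLike.congr_fun h N
    rw [Finsupp.add_apply, (hN N le_rfl).1, (hN N le_rfl).2 i, hz, if_pos] at h1
    · simp at h1
    · simp [r]; omega
  · rw [map_add, LinearMap.add_apply, bilinForm_apply z, hz0 _ fun m hm => (hN m hm).2 i, add_zero]
  · simp only [map_add, LinearMap.add_apply, bilinForm_apply, form_comm x z, hzx, hzz]
    ring

/-- The presentation of the standard model. -/
noncomputable def standardPresentation (p : ℕ) : Presentation p (ℕ →₀ ZMod p) (bilinForm p) (Carrier p) where
  vec := Carrier.vec
  scal := Carrier.scal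
  vec_injective _ _ h := Carrier.vec.inj h
  scal_injective _ _ h := Carrier.scal.inj h
  vec_ne_scal _ _ h := by cases h
  vec_or_scal
    | .vec x => Or.inl ⟨x, rfl⟩
    | .scal c => Or.inr ⟨c, rfl⟩
  zero _ := rfl
  rel_vec _ := Iff.rfl
  rel_scal _ := Iff.rfl
  rel_add _ := Iff.rfl
  rel_dot _ := Iff.rfl
  symm := form_comm

end Standard

/-! ### Elementary classes -/

/-- The property `P` of tuples is expressed by a formula. -/
def IsElementary {α : Type} (P : ∀ (K : Type) [lang.Structure K], (α → K) → Prop) : Prop :=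
  ∃ φ : lang.Formula α, ∀ (K : Type) [lang.Structure K] (v : α → K), φ.Realize v ↔ P K v

/-- `x · y = t`. -/
def IsDot {K : Type} [lang.Structure K] (x y t : K) : Prop :=
  Structure.RelMap (L := lang) Rel.dot ![x, y, t]

/-- `x` belongs to the scalar sort. -/
def IsScal {K : Type} [lang.Structure K] (x : K) : Prop :=
  Structure.RelMap (L := lang) Rel.scal ![x]

namespace IsElementary

variable {α : Type} {P Q : ∀ (K : Type) [lang.Structure K], (α → K) → Prop}

theorem const (q : Prop) : IsElementary (α := α) fun _ _ _ => q := by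
  by_cases hq : q
  · exact ⟨⊤, fun _ _ _ => iff_of_true (BoundedFormula.realize_top.2 trivial) hq⟩
  · exact ⟨⊥, fun _ _ _ => iff_of_false (fun h => BoundedFormula.realize_bot.1 h) hq⟩

theorem eq (a b : α) : IsElementary fun _ _ v => v a = v b :=
  ⟨Term.equal (Term.var a) (Term.var b), fun _ _ v => by simp⟩

theorem eq_zeroVec (a : α) : IsElementary fun K _ v => v a = zeroVec K :=
  ⟨Term.equal (Term.var a) (Term.func (L := lang) Func.zero ![]), fun K _ v => by
    refine Formula.realize_equal.trans (iff_of_eq (congrArg (v a = ·) ?_))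
    exact congrArg (Structure.funMap (L := lang) (M := K) (n := 0) Func.zero) (Subsingleton.elim _ _)⟩

theorem rel {n : ℕ} (r : lang.Relations n) (t : Fin n → α) :
    IsElementary fun K _ v => Structure.RelMap (M := K) r fun i => v (t i) :=
  ⟨r.formula fun i => Term.var (t i), fun _ _ _ => Formula.realize_rel⟩

theorem isVec (a : α) : IsElementary fun _ _ v => IsVec (v a) := by
  obtain ⟨φ, hφ⟩ := rel (n := 1) Rel.vec ![a]
  exact ⟨φ, fun K _ v => (hφ K v).trans (iff_of_eq (congrArg _ (by ext i; fin_cases i; rfl)))⟩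

theorem isScal (a : α) : IsElementary fun _ _ v => IsScal (v a) := by
  obtain ⟨φ, hφ⟩ := rel (n := 1) Rel.scal ![a]
  exact ⟨φ, fun K _ v => (hφ K v).trans (iff_of_eq (congrArg _ (by ext i; fin_cases i; rfl)))⟩

theorem isAdd (a b c : α) : IsElementary fun _ _ v => IsAdd (v a) (v b) (v c) := by
  obtain ⟨φ, hφ⟩ := rel (n := 3) Rel.add ![a, b, c]
  exact ⟨φ, fun K _ v => (hφ K v).trans (iff_of_eq (congrArg _ (by ext i; fin_cases i <;> rfl)))⟩

theorem isDot (a b c : α) : IsElementary fun _ _ v => IsDot (v a) (v b) (v c) := by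
  obtain ⟨φ, hφ⟩ := rel (n := 3) Rel.dot ![a, b, c]
  exact ⟨φ, fun K _ v => (hφ K v).trans (iff_of_eq (congrArg _ (by ext i; fin_cases i <;> rfl)))⟩

theorem not (hP : IsElementary P) : IsElementary fun K _ v => ¬ P K v := by
  obtain ⟨φ, hφ⟩ := hP
  exact ⟨φ.not, fun K _ v => by rw [Formula.realize_not, hφ]⟩

theorem and (hP : IsElementary P) (hQ : IsElementary Q) :
    IsElementary fun K _ v => P K v ∧ Q K v := by
  obtain ⟨φ, hφ⟩ := hP
  obtain ⟨ψ, hψ⟩ := hQ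
  exact ⟨φ ⊓ ψ, fun K _ v => by rw [Formula.realize_inf, hφ, hψ]⟩

theorem or (hP : IsElementary P) (hQ : IsElementary Q) :
    IsElementary fun K _ v => P K v ∨ Q K v := by
  obtain ⟨φ, hφ⟩ := hP
  obtain ⟨ψ, hψ⟩ := hQ
  exact ⟨φ ⊔ ψ, fun K _ v => by rw [Formula.realize_sup, hφ, hψ]⟩

theorem imp (hP : IsElementary P) (hQ : IsElementary Q) :
    IsElementary fun K _ v => P K v → Q K v := by
  obtain ⟨φ, hφ⟩ := hP
  obtain ⟨ψ, hψ⟩ := hQ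
  exact ⟨φ.imp ψ, fun K _ v => by rw [Formula.realize_imp, hφ, hψ]⟩

theorem forall_finite {ι : Type} [Finite ι]
    {P : ι → ∀ (K : Type) [lang.Structure K], (α → K) → Prop} (hP : ∀ i, IsElementary (P i)) :
    IsElementary fun K _ v => ∀ i, P i K v := by
  choose φ hφ using hP
  exact ⟨Formula.iInf φ, fun K _ v => by rw [Formula.realize_iInf]; exact forall_congr' fun i => hφ i K v⟩

theorem exists_finite {ι : Type} [Finite ι]
    {P : ι → ∀ (K : Type) [lang.Structure K], (α → K) → Prop} (hP : ∀ i, IsElementary (P i)) :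
    IsElementary fun K _ v => ∃ i, P i K v := by
  choose φ hφ using hP
  exact ⟨Formula.iSup φ, fun K _ v => by rw [Formula.realize_iSup]; exact exists_congr fun i => hφ i K v⟩

theorem forall_tuple {β : Type} [Finite β]
    {P : ∀ (K : Type) [lang.Structure K], (α → K) → (β → K) → Prop}
    (hP : IsElementary (α := α ⊕ β) fun K _ v => P K (fun a => v (.inl a)) fun b => v (.inr b)) :
    IsElementary fun K _ v => ∀ x : β → K, P K v x := by
  obtain ⟨φ, hφ⟩ := hP
  exact ⟨Formula.iAlls β φ, fun K _ v => by
    rw [Formula.realize_iAlls]; exact forall_congr' fun x => hφ K _⟩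

theorem all {P : ∀ (K : Type) [lang.Structure K], (α → K) → K → Prop}
    (hP : IsElementary (α := α ⊕ Unit) fun K _ v => P K (fun a => v (.inl a)) (v (.inr ()))) :
    IsElementary fun K _ v => ∀ x : K, P K v x := by
  obtain ⟨φ, hφ⟩ := hP
  exact ⟨Formula.iAlls Unit φ, fun K _ v => by
    rw [Formula.realize_iAlls]
    exact ⟨fun h x => (hφ K _).1 (h fun _ => x), fun h x => (hφ K _).2 (h (x ()))⟩⟩

theorem ex {P : ∀ (K : Type) [lang.Structure K], (α → K) → K → Prop}
    (hP : IsElementary (α := α ⊕ Unit) fun K _ v => P K (fun a => v (.inl a)) (v (.inr ()))) :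
    IsElementary fun K _ v => ∃ x : K, P K v x := by
  obtain ⟨φ, hφ⟩ := hP
  exact ⟨Formula.iExs Unit φ, fun K _ v => by
    rw [Formula.realize_iExs]
    exact ⟨fun ⟨x, h⟩ => ⟨x (), (hφ K _).1 h⟩, fun ⟨x, h⟩ => ⟨fun _ => x, (hφ K _).2 h⟩⟩⟩

variable {M N : Type} [lang.Structure M] [lang.Structure N]

theorem exists_of_completeTheory [Finite α] [hN : N ⊨ lang.completeTheory M]
    (hP : IsElementary P) (h : ∃ v, P M v) : ∃ w, P N w := by
  obtain ⟨φ, hφ⟩ := hP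
  let σ : lang.Sentence := Formula.iExs α (φ.relabel Sum.inr : lang.Formula (Empty ⊕ α))
  have hσ : ∀ (K : Type) [lang.Structure K], K ⊨ σ ↔ ∃ v, P K v := fun K _ => by
    simp only [σ, Sentence.Realize]
    rw [Formula.realize_iExs]
    exact exists_congr fun v => by rw [Formula.realize_relabel, ← hφ]; rfl
  exact (hσ N).1 ((realize_iff_of_model_completeTheory M N σ).2 ((hσ M).2 h))

/-- A tuple with an algebraic elementary property `P` corresponds to some tuple with all the same
elementary properties in any elementarily equivalent structure. -/
theorem exists_same_type [Finite α] [hN : N ⊨ lang.completeTheory M]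
    (hP : IsElementary P) {v : α → M} (h : P M v) (hfin : {w : α → N | P N w}.Finite) :
    ∃ w, P N w ∧ ∀ Q : ∀ (K : Type) [lang.Structure K], (α → K) → Prop,
      IsElementary Q → Q M v → Q N w := by
  by_contra! hcon
  have : Finite {w : α → N | P N w} := hfin
  choose Q hQ hQM hQN using fun w : {w : α → N | P N w} => hcon w w.2
  have : Finite {w : α → N // P N w} := hfin
  -- Every one of the finitely many solutions `w` of `P` violates its own `Q w`, but `v` satisfies
  -- all of them at once, and this conjunction transfers to `N`.
  let R : ∀ (K : Type) [lang.Structure K], (α → K) → Prop := fun K _ u => ∀ w, Q w K u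
  have hR : IsElementary R := by
    choose φ hφ using hQ
    exact ⟨Formula.iInf φ, fun K _ v => by
      rw [Formula.realize_iInf]; exact forall_congr' fun i => hφ i K v⟩
  obtain ⟨w, hw, hw'⟩ := exists_of_completeTheory (N := N) (hP.and hR) ⟨v, h, fun w => hQM w⟩
  exact hQN ⟨w, hw⟩ (hw' ⟨w, hw⟩)

end IsElementary

/-! ### Models of the theory -/

namespace Presentation

variable {p : ℕ} {V : Type*} [AddCommGroup V] [Module (ZMod p) V]
  {B : V →ₗ[ZMod p] V →ₗ[ZMod p] ZMod p} {K : Type} [lang.Structure K]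

theorem isVec_iff (P : Presentation p V B K) {k : K} : IsVec k ↔ ∃ x, k = P.vec x :=
  P.rel_vec _

theorem isScal_iff (P : Presentation p V B K) {k : K} : IsScal k ↔ ∃ c, k = P.scal c :=
  P.rel_scal _

theorem isAdd_iff (P : Presentation p V B K) {k l m : K} :
    IsAdd k l m ↔ ∃ x y, k = P.vec x ∧ l = P.vec y ∧ m = P.vec (x + y) :=
  P.rel_add _

theorem isDot_iff (P : Presentation p V B K) {k l m : K} :
    IsDot k l m ↔ ∃ x y, k = P.vec x ∧ l = P.vec y ∧ m = P.scal (B x y) :=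
  P.rel_dot _

theorem zeroVec_eq (P : Presentation p V B K) : zeroVec K = P.vec 0 :=
  P.zero _

end Presentation

/-- The scalars of `K` are labelled by `s`, and addition and the bilinear form have the expected
basic properties. -/
def IsLabelling {p : ℕ} (K : Type) [lang.Structure K] (s : ZMod p → K) : Prop :=
  (∀ x : K, IsVec x ∨ ∃ c, x = s c) ∧
  (∀ c, IsScal (s c)) ∧
  (∀ c, ¬ IsVec (s c)) ∧
  (∀ c d, s c = s d → c = d) ∧
  (∀ x : K, x = zeroVec K → IsVec x ∧ ∀ y : K, IsVec y → IsDot x y (s 0)) ∧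
  (∀ x y z : K, IsAdd x y z → IsVec x ∧ IsVec y ∧ IsVec z ∧
    ∀ (w : K) (c d : ZMod p), IsDot x w (s c) → IsDot y w (s d) → IsDot z w (s (c + d))) ∧
  (∀ x y : K, IsVec x → IsVec y → ∃ z : K, IsAdd x y z) ∧
  (∀ x y z : K, IsDot x y z → IsVec x ∧ IsVec y ∧ IsDot y x z) ∧
  (∀ x y : K, IsVec x → IsVec y → ∃ c, IsDot x y (s c)) ∧
  (∀ x y z w : K, IsDot x y z → IsDot x y w → z = w) ∧
  (∀ x y : K, IsVec x → IsVec y → (∀ w z : K, IsDot x w z → IsDot y w z) → x = y) ∧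
  ∀ x : K, IsScal x → ¬ IsVec x

/-- For any `n` vectors `b i` and any vector `x` there is a vector, distinct from all `b i`, with
the same products with the `b i` as `x`, and with product `c` with itself. -/
def HasGenericVectors {p : ℕ} (n : ℕ) (c : ZMod p) (K : Type) [lang.Structure K]
    (s : ZMod p → K) : Prop :=
  ∀ b : Fin n → K, ∀ x : K, (∀ i, IsVec (b i)) → IsVec x →
    ∃ y : K, (∀ i, ¬ y = b i ∧ ∀ t : K, IsDot x (b i) t → IsDot y (b i) t) ∧ IsDot y y (s c)

section

variable {p : ℕ}

/-- Quantifiers over `ZMod p` are finite conjunctions and disjunctions, so the definition can be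
followed connective by connective. -/
theorem isElementary_isLabelling [Fact p.Prime] :
    IsElementary fun K [lang.Structure K] (s : ZMod p → K) => IsLabelling K s := by
  unfold IsLabelling
  repeat' first
    | exact IsElementary.isVec _
    | exact IsElementary.isScal _
    | exact IsElementary.isAdd _ _ _
    | exact IsElementary.isDot _ _ _
    | exact IsElementary.eq _ _
    | exact IsElementary.eq_zeroVec _
    | exact IsElementary.const _
    | refine IsElementary.and ?_ ?_
    | refine IsElementary.or ?_ ?_
    | refine IsElementary.not ?_
    | refine IsElementary.all ?_
    | refine IsElementary.ex ?_
    | refine IsElementary.imp ?_ ?_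
    | refine IsElementary.forall_finite fun _ => ?_
    | refine IsElementary.exists_finite fun _ => ?_

theorem isElementary_hasGenericVectors (n : ℕ) (c : ZMod p) :
    IsElementary fun K [lang.Structure K] (s : ZMod p → K) => HasGenericVectors n c K s := by
  unfold HasGenericVectors
  refine IsElementary.forall_tuple ?_
  repeat' first
    | exact IsElementary.isVec _
    | exact IsElementary.isDot _ _ _
    | exact IsElementary.eq _ _
    | refine IsElementary.and ?_ ?_
    | refine IsElementary.not ?_
    | refine IsElementary.all ?_
    | refine IsElementary.ex ?_
    | refine IsElementary.imp ?_ ?_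
    | refine IsElementary.forall_finite fun _ => ?_

theorem Presentation.isLabelling {V : Type*} [Fact p.Prime] [AddCommGroup V] [Module (ZMod p) V]
    {B : V →ₗ[ZMod p] V →ₗ[ZMod p] ZMod p} {K : Type} [lang.Structure K]
    (P : Presentation p V B K) (hB : ExtensionProperty B) : IsLabelling K P.scal := by
  refine ⟨fun x => ?_, ?_, ?_, ?_, ?_, ?_, ?_, ?_, ?_, ?_, ?_, ?_⟩
  · rw [P.isVec_iff]; exact P.vec_or_scal x
  · simp [P.isScal_iff]
  · simp [P.isVec_iff]
  · simp
  · rintro _ rfl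
    rw [P.zeroVec_eq]
    refine ⟨P.isVec_iff.2 ⟨0, rfl⟩, fun y hy => ?_⟩
    obtain ⟨y, rfl⟩ := P.isVec_iff.1 hy
    exact P.isDot_iff.2 ⟨0, y, rfl, rfl, by simp⟩
  · intro x y z h
    obtain ⟨x, y, rfl, rfl, rfl⟩ := P.isAdd_iff.1 h
    refine ⟨P.isVec_iff.2 ⟨x, rfl⟩, P.isVec_iff.2 ⟨y, rfl⟩, P.isVec_iff.2 ⟨_, rfl⟩, ?_⟩
    intro w c d hx hy
    obtain ⟨x', w', hx', rfl, hc⟩ := P.isDot_iff.1 hx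
    obtain ⟨y', w'', hy', hw, hd⟩ := P.isDot_iff.1 hy
    rw [P.vec_inj] at hx' hy' hw
    rw [P.scal_inj] at hc hd
    subst hx' hy' hw hc hd
    exact P.isDot_iff.2 ⟨_, _, rfl, rfl, by simp⟩
  · intro x y hx hy
    obtain ⟨x, rfl⟩ := P.isVec_iff.1 hx
    obtain ⟨y, rfl⟩ := P.isVec_iff.1 hy
    exact ⟨_, P.isAdd_iff.2 ⟨x, y, rfl, rfl, rfl⟩⟩
  · intro x y z h
    obtain ⟨x, y, rfl, rfl, rfl⟩ := P.isDot_iff.1 h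
    exact ⟨P.isVec_iff.2 ⟨x, rfl⟩, P.isVec_iff.2 ⟨y, rfl⟩,
      P.isDot_iff.2 ⟨y, x, rfl, rfl, by rw [P.symm]⟩⟩
  · intro x y hx hy
    obtain ⟨x, rfl⟩ := P.isVec_iff.1 hx
    obtain ⟨y, rfl⟩ := P.isVec_iff.1 hy
    exact ⟨_, P.isDot_iff.2 ⟨x, y, rfl, rfl, rfl⟩⟩
  · intro x y z w h h'
    obtain ⟨x, y, rfl, rfl, rfl⟩ := P.isDot_iff.1 h
    obtain ⟨x', y', hx, hy, rfl⟩ := P.isDot_iff.1 h'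
    rw [P.vec_inj] at hx hy
    rw [hx, hy]
  · intro x y hx hy h
    obtain ⟨x, rfl⟩ := P.isVec_iff.1 hx
    obtain ⟨y, rfl⟩ := P.isVec_iff.1 hy
    by_contra hxy
    obtain ⟨w, hw⟩ := hB.nondegenerate (d := x - y) (by simpa [sub_eq_zero] using hxy)
    obtain ⟨y', w', hy', hw', hc⟩ := P.isDot_iff.1
      (h (P.vec w) (P.scal (B x w)) (P.isDot_iff.2 ⟨x, w, rfl, rfl, rfl⟩))
    rw [P.vec_inj] at hy' hw'
    rw [P.scal_inj] at hc
    subst hy' hw'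
    rw [P.symm, map_sub, LinearMap.sub_apply, hc, sub_self] at hw
    exact hw rfl
  · intro x hx hx'
    obtain ⟨c, rfl⟩ := P.isScal_iff.1 hx
    obtain ⟨x, hx⟩ := P.isVec_iff.1 hx'
    simp at hx

theorem Presentation.hasGenericVectors {V : Type*} [Fact p.Prime] [AddCommGroup V]
    [Module (ZMod p) V] {B : V →ₗ[ZMod p] V →ₗ[ZMod p] ZMod p} {K : Type} [lang.Structure K]
    (P : Presentation p V B K) (hB : ExtensionProperty B) (n : ℕ) (c : ZMod p) :
    HasGenericVectors n c K P.scal := by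
  intro b x hb hx
  choose b' hb' using fun i => P.isVec_iff.1 (hb i)
  obtain ⟨x, rfl⟩ := P.isVec_iff.1 hx
  obtain ⟨y, hy, hyb, hyy⟩ := hB (Submodule.span _ (Set.range b'))
    (Submodule.fg_span (Set.finite_range _)) (B x) c
  refine ⟨P.vec y, fun i => ⟨fun h => ?_, fun t ht => ?_⟩, P.isDot_iff.2 ⟨y, y, rfl, rfl, by rw [hyy]⟩⟩
  · rw [hb', P.vec_inj] at h
    exact hy (h ▸ Submodule.subset_span ⟨i, rfl⟩)
  · obtain ⟨x', z, hx', hz, rfl⟩ := P.isDot_iff.1 ht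
    rw [hb', P.vec_inj] at hz
    rw [P.vec_inj] at hx'
    subst hz hx'
    rw [← hyb _ (Submodule.subset_span ⟨i, rfl⟩)]
    exact P.isDot_iff.2 ⟨y, _, rfl, hb' i, rfl⟩

/-- A labelled structure with generic vectors has a presentation. -/
theorem IsLabelling.exists_presentation [Fact p.Prime] {K : Type} [lang.Structure K]
    {s : ZMod p → K} (h : IsLabelling K s) (hg : ∀ n c, HasGenericVectors n c K s) :
    ∃ (V : Type) (_ : AddCommGroup V) (_ : Module (ZMod p) V)
      (B : V →ₗ[ZMod p] V →ₗ[ZMod p] ZMod p) (_ : Presentation p V B K), ExtensionProperty B := by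
  obtain ⟨hor, hscal, hnvec, hinj, hzero, hadd, hadd_ex, hdot, hdot_ex, hdot_uniq, hext, hns⟩ := h
  let X := {x : K // IsVec x}
  choose d hd using fun x y : X => hdot_ex x y x.2 y.2
  have hd_iff : ∀ (x y : X) c, IsDot (x : K) y (s c) ↔ d x y = c := fun x y c =>
    ⟨fun h => hinj _ _ (hdot_uniq _ _ _ _ (hd x y) h), fun h => h ▸ hd x y⟩
  have hd_symm : ∀ x y, d x y = d y x := fun x y => (hd_iff _ _ _).1 (hdot _ _ _ (hd y x)).2.2
  have hd_inj : Function.Injective d := fun x y hxy => by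
    refine Subtype.ext (hext _ _ x.2 y.2 fun w z hz => ?_)
    have hw := (hdot _ _ _ hz).2.1
    obtain rfl := hdot_uniq _ _ _ _ (hd x ⟨w, hw⟩) hz
    rw [hxy]
    exact hd y ⟨w, hw⟩
  have hd_add : ∀ x y z : X, IsAdd (x : K) y z ↔ d z = d x + d y := by
    have h1 : ∀ x y z : X, IsAdd (x : K) y z → d z = d x + d y := fun x y z hz => by
      funext w
      exact (hd_iff _ _ _).1 ((hadd _ _ _ hz).2.2.2 w _ _ (hd x w) (hd y w))
    refine fun x y z => ⟨h1 x y z, fun hz => ?_⟩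
    obtain ⟨z', hz'⟩ := hadd_ex x y x.2 y.2
    have h2 := h1 x y ⟨z', (hadd _ _ _ hz').2.2.1⟩ hz'
    rw [← hz] at h2
    exact (congrArg Subtype.val (hd_inj h2)) ▸ hz'
  let zero : X := ⟨zeroVec K, (hzero _ rfl).1⟩
  have hd_zero : d zero = 0 := funext fun y => (hd_iff _ _ _).1 ((hzero _ rfl).2 y y.2)
  have hadd_mem : ∀ {u v}, u ∈ Set.range d → v ∈ Set.range d → u + v ∈ Set.range d := by
    rintro _ _ ⟨x, rfl⟩ ⟨y, rfl⟩
    obtain ⟨z, hz⟩ := hadd_ex x y x.2 y.2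
    exact ⟨⟨z, (hadd _ _ _ hz).2.2.1⟩, (hd_add _ _ _).1 hz⟩
  -- Each vector is identified with its function of products with all vectors, injectively by
  -- extensionality. The group laws hold for functions, so they need not be among the axioms.
  let V : Submodule (ZMod p) (X → ZMod p) :=
    { carrier := Set.range d
      add_mem' := hadd_mem
      zero_mem' := ⟨zero, hd_zero⟩
      smul_mem' := fun c u hu => by
        -- Scalars of the prime field are natural numbers, so closure under addition suffices.
        have h1 : ∀ n : ℕ, (n : ZMod p) • u ∈ Set.range d := fun n => by
          induction n with
          | zero => exact ⟨zero, by simp [hd_zero]⟩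
          | succ n ih =>
            rw [Nat.cast_succ, add_smul, one_smul]
            exact hadd_mem ih hu
        simpa using h1 c.val }
  let e : X ≃ V := Equiv.ofInjective d hd_inj
  have he : ∀ x, ((e x : V) : X → ZMod p) = d x := fun x => rfl
  have he' : ∀ u : V, d (e.symm u) = (u : X → ZMod p) := fun u => by
    rw [← he, e.apply_symm_apply]
  have hsymm : ∀ u v : V, (u : X → ZMod p) (e.symm v) = (v : X → ZMod p) (e.symm u) := fun u v => by
    rw [← he' u, ← he' v, hd_symm]
  let B : V →ₗ[ZMod p] V →ₗ[ZMod p] ZMod p :=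
    LinearMap.mk₂ _ (fun u v => (u : X → ZMod p) (e.symm v)) (fun _ _ _ => rfl) (fun _ _ _ => rfl)
      (fun u v w => by rw [hsymm, hsymm u v, hsymm u w]; rfl)
      (fun c u v => by rw [hsymm, hsymm u v]; rfl)
  have hB : ∀ x y, B (e x) (e y) = d x y := fun x y => by
    change d x (e.symm (e y)) = _
    rw [e.symm_apply_apply]
  have h3 : ∀ t : Fin 3 → K, t = ![t 0, t 1, t 2] := fun t => by
    ext i; fin_cases i <;> rfl
  have h1 : ∀ t : Fin 1 → K, t = ![t 0] := fun t => by ext i; fin_cases i; rfl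
  let P : Presentation p V B K :=
    { vec := fun u => (e.symm u : X)
      scal := s
      vec_injective := Subtype.val_injective.comp e.symm.injective
      scal_injective := fun c d => hinj c d
      vec_ne_scal := fun u c h => hnvec c (h ▸ (e.symm u).2)
      vec_or_scal := fun k => (hor k).imp_left fun hk => ⟨e ⟨k, hk⟩, by simp⟩
      zero := fun t => by
        have : (e.symm (0 : V)) = zero := by
          rw [Equiv.symm_apply_eq]; exact Subtype.ext hd_zero.symm
        rw [this, Subsingleton.elim t (![] : Fin 0 → K)]
        rfl
      rel_vec := fun t => by
        rw [h1 t]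
        exact ⟨fun hk => ⟨e ⟨t 0, hk⟩, by simp⟩, fun ⟨u, hu⟩ => by
          have : t 0 = (e.symm u : X) := hu
          rw [this]
          exact (e.symm u).2⟩
      rel_scal := fun t => by
        rw [h1 t]
        exact ⟨fun hk => (hor (t 0)).resolve_left (hns _ hk), fun ⟨c, hc⟩ => by
          have : t 0 = s c := hc
          rw [this]
          exact hscal c⟩
      rel_add := fun t => by
        constructor
        · intro ht
          rw [h3 t] at ht
          obtain ⟨h0, h1, h2, -⟩ := hadd _ _ _ ht
          refine ⟨e ⟨_, h0⟩, e ⟨_, h1⟩, by simp, by simp, ?_⟩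
          have : e ⟨_, h0⟩ + e ⟨_, h1⟩ = e ⟨_, h2⟩ :=
            Subtype.ext ((hd_add ⟨_, h0⟩ ⟨_, h1⟩ ⟨_, h2⟩).1 ht).symm
          simp [this]
        · rintro ⟨u, v, h0, h1, h2⟩
          rw [h3 t, h0, h1, h2]
          exact (hd_add _ _ _).2 (by rw [he', he', he']; rfl)
      rel_dot := fun t => by
        constructor
        · intro ht
          rw [h3 t] at ht
          obtain ⟨h0, h1, -⟩ := hdot _ _ _ ht
          refine ⟨e ⟨_, h0⟩, e ⟨_, h1⟩, by simp, by simp, ?_⟩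
          rw [hB]
          exact hdot_uniq _ _ _ _ ht (hd ⟨_, h0⟩ ⟨_, h1⟩)
        · rintro ⟨u, v, h0, h1, h2⟩
          rw [h3 t, h0, h1, h2]
          refine (hd_iff (e.symm u) (e.symm v) _).2 ?_
          rw [← hB, e.apply_symm_apply, e.apply_symm_apply]
      symm := hsymm }
  refine ⟨V, inferInstance, inferInstance, B, P, ?_⟩
  refine extensionProperty_of_finite_families (fun u hu => ?_) fun n b x c => ?_
  · refine Subtype.ext (funext fun y => ?_)
    have := hu (e y)
    rw [P.symm] at this
    simpa [B] using this
  · obtain ⟨y, hy, hyy⟩ := hg n c (fun i => P.vec (b i)) (P.vec x)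
      (fun i => P.isVec_iff.2 ⟨_, rfl⟩) (P.isVec_iff.2 ⟨_, rfl⟩)
    obtain ⟨y, y', rfl, hyy', hc⟩ := P.isDot_iff.1 hyy
    rw [P.vec_inj] at hyy'
    subst hyy'
    refine ⟨y, fun i => ⟨fun h => (hy i).1 (h ▸ rfl), ?_⟩, (P.scal_injective hc).symm⟩
    obtain ⟨z, w, hz, hw, hzw⟩ := P.isDot_iff.1
      ((hy i).2 (P.scal (B x (b i))) (P.isDot_iff.2 ⟨_, _, rfl, rfl, rfl⟩))
    rw [P.vec_inj] at hz hw
    subst hz hw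
    exact (P.scal_injective hzw).symm

/-- Every model of the theory has a presentation. -/
theorem exists_presentation (p : ℕ) [Fact p.Prime] (N : Type) [lang.Structure N]
    [hN : N ⊨ theory p] :
    ∃ (V : Type) (_ : AddCommGroup V) (_ : Module (ZMod p) V)
      (B : V →ₗ[ZMod p] V →ₗ[ZMod p] ZMod p) (_ : Presentation p V B N), ExtensionProperty B := by
  have hN' : N ⊨ lang.completeTheory (Carrier p) := hN
  have hM := (standardPresentation p).isLabelling bilinForm_extensionProperty
  obtain ⟨s₀, hs₀⟩ := isElementary_isLabelling.exists_of_completeTheory (N := N) ⟨_, hM⟩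
  -- The labels are not named in the language, so each axiom alone might require its own labelling.
  -- Every labelling takes its values among those of `s₀`; by this finiteness one labelling serves
  -- the whole scheme.
  have hfin : {s : ZMod p → N | IsLabelling N s}.Finite := by
    refine (Set.Finite.pi' fun _ : ZMod p => Set.finite_range s₀).subset fun s hs c => ?_
    rcases hs₀.1 (s c) with h | ⟨d, h⟩
    · exact absurd h (hs.2.2.1 c)
    · exact ⟨d, h.symm⟩
  obtain ⟨s, hs, hall⟩ := isElementary_isLabelling.exists_same_type hM hfin
  exact hs.exists_presentation fun n c => hall _ (isElementary_hasGenericVectors n c)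
    ((standardPresentation p).hasGenericVectors bilinForm_extensionProperty n c)

end

/-! ### Counting types -/

/-- The number of types of `m`-tuples over a finite tuple `g` is bounded by a function that is
exponential in the length of `g`. -/
theorem Presentation.card_le_of_pairwise_distinguished {p : ℕ} [Fact p.Prime] {V : Type*}
    [AddCommGroup V] [Module (ZMod p) V] {B : V →ₗ[ZMod p] V →ₗ[ZMod p] ZMod p} {K : Type*}
    [lang.Structure K] (P : Presentation p V B K) (hB : ExtensionProperty B)
    {κ τ : Type*} [Fintype κ] {m : ℕ} (g : κ → K) (b : τ → Fin m → K)
    (hb : ∀ t t', t ≠ t' → ∃ φ : lang.Formula (κ ⊕ Fin m),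
      ¬ (φ.Realize (Sum.elim g (b t)) ↔ φ.Realize (Sum.elim g (b t')))) :
    Nat.card τ ≤ (p + 1) ^ m * (p ^ Fintype.card κ + 1) ^ p ^ m * ((p ^ Fintype.card κ) ^ m *
      (p ^ m) ^ m) := by
  classical
  let A : Submodule (ZMod p) V := LinearMap.range (Fintype.linearCombination (ZMod p)
    fun j => P.vecPart (g j))
  have hA : Nat.card A ≤ p ^ Fintype.card κ := by
    have := Nat.card_le_card_of_surjective _ (LinearMap.surjective_rangeRestrict
      (Fintype.linearCombination (ZMod p) fun j => P.vecPart (g j)))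
    rwa [Nat.card_fun, Nat.card_zmod, Nat.card_eq_fintype_card (α := κ)] at this
  have : Finite A := inferInstanceAs (Finite (Set.range _))
  let Δ := ((Fin m → Option (ZMod p)) × ((Fin m → ZMod p) → Option A)) ×
    ((Fin m → κ → ZMod p) × (Fin m → Fin m → ZMod p))
  -- The data that determine the type over `g`: scalars, the value of each linear combination that
  -- falls into the span `A` of `g` (`none` if it does not), and the two blocks of the Gram matrix.
  let data : τ → Δ := fun t =>
    ((fun i => P.scalPart (b t i), fun e =>
      if h : ∑ i, e i • P.vecPart (b t i) ∈ A then some ⟨_, h⟩ else none),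
      (fun i j => B (P.vecPart (b t i)) (P.vecPart (g j)),
        fun i j => B (P.vecPart (b t i)) (P.vecPart (b t j))))
  have hker : ∀ t t', (data t).1.2 = (data t').1.2 → ∀ e : κ ⊕ Fin m → ZMod p,
      ∑ i, e i • P.vecPart (Sum.elim g (b t) i) = 0 →
      ∑ i, e i • P.vecPart (Sum.elim g (b t') i) = 0 := by
    intro t t' h e he
    rw [Fintype.sum_sum_type] at he ⊢
    simp only [Sum.elim_inl, Sum.elim_inr] at he ⊢
    have hmem : ∑ i, e (.inr i) • P.vecPart (b t i) ∈ A := by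
      rw [eq_neg_of_add_eq_zero_right he]
      exact A.neg_mem ⟨fun j => e (.inl j), by simp [Fintype.linearCombination_apply]⟩
    have h1 := congrFun h fun i => e (.inr i)
    simp only [data, dif_pos hmem] at h1
    split_ifs at h1 with h2
    rw [Option.some_inj, Subtype.mk.injEq] at h1
    rw [← h1, he]
  have hinj : Function.Injective data := by
    intro t t' h
    by_contra hne
    obtain ⟨φ, hφ⟩ := hb t t' hne
    refine hφ (P.realize_formula_iff_of_gram (P' := P) hB hB φ ?_ ?_ ?_)
    · rintro (j | i)
      · rfl
      · exact congrFun (congrArg (fun x : Δ => x.1.1) h) i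
    · rintro (j | i) (j' | i')
      · rfl
      · rw [P.symm, P.symm (P.vecPart (Sum.elim g (b t') _))]
        exact congrFun (congrFun (congrArg (fun x : Δ => x.2.1) h) i') j
      · exact congrFun (congrFun (congrArg (fun x : Δ => x.2.1) h) i) j'
      · exact congrFun (congrFun (congrArg (fun x : Δ => x.2.2) h) i) i'
    · exact fun e => ⟨hker t t' (congrArg (fun x : Δ => x.1.2) h) e,
        hker t' t (congrArg (fun x : Δ => x.1.2) h.symm) e⟩
  refine (Nat.card_le_card_of_injective data hinj).trans ?_
  simp only [Δ, Nat.card_prod, Nat.card_fun, Nat.card_eq_fintype_card (α := Fin m),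
    Fintype.card_fin, Nat.card_zmod, Finite.card_option, Nat.card_eq_fintype_card (α := κ)]
  gcongr

theorem exists_mul_pow_lt_two_pow (C Q : ℕ) (hC : 0 < C) (hQ : 0 < Q) :
    ∃ n, C * Q ^ n < 2 ^ (n * n) := by
  -- With `n = C * Q` the left side is at most `n ^ n`, which is less than `(2 ^ n) ^ n`.
  refine ⟨C * Q, ?_⟩
  have hn : C * Q ≠ 0 := by positivity
  calc C * Q ^ (C * Q) ≤ C ^ (C * Q) * Q ^ (C * Q) := by
        gcongr
        exact Nat.le_self_pow hn C
    _ = (C * Q) ^ (C * Q) := (mul_pow _ _ _).symm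
    _ < (2 ^ (C * Q)) ^ (C * Q) := Nat.pow_lt_pow_left Nat.lt_two_pow_self hn
    _ = 2 ^ (C * Q * (C * Q)) := (pow_mul _ _ _).symm

theorem isDependent_two (p : ℕ) [Fact p.Prime] : ModelDividing.IsDependent 2 (theory p) := by
  rintro ⟨k, m, ψ, N, a, b, h⟩
  obtain ⟨V, _, _, B, P, hB⟩ := exists_presentation p N
  have hp : 0 < p := (Fact.out : p.Prime).pos
  -- The constants come from the bound on types for `n * (k 0 + k 1)` parameters, after replacing `p
  -- ^ _ + 1` by `2 * p ^ _`.
  obtain ⟨n, hn⟩ := exists_mul_pow_lt_two_pow ((p + 1) ^ m * 2 ^ p ^ m * (p ^ m) ^ m)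
    (p ^ ((k 0 + k 1) * p ^ m + (k 0 + k 1) * m)) (by positivity) (by positivity)
  have hcard := P.card_le_of_pairwise_distinguished hB
    (κ := Σ j : Fin 2, Fin n × Fin (k j)) (τ := Set (Fin 2 → Fin n))
    (fun x => a x.1 x.2.1 x.2.2) (fun t => b ((fun i j => (i j : ℕ)) '' t)) (by
      intro t t' hne
      obtain ⟨i, hi⟩ : ∃ i, ¬ (i ∈ t ↔ i ∈ t') := by
        by_contra! hcon
        exact hne (Set.ext hcon)
      have hval : Function.Injective fun (i : Fin 2 → Fin n) (j : Fin 2) => (i j : ℕ) :=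
        fun i i' hii => funext fun j => Fin.ext (congrFun hii j)
      refine ⟨ψ.relabel (Sum.map (fun y => ⟨y.1, i y.1, y.2⟩) id), ?_⟩
      have key : ∀ t : Set (Fin 2 → Fin n), (ψ.relabel
          (Sum.map (fun y => (⟨y.1, i y.1, y.2⟩ : Σ j : Fin 2, Fin n × Fin (k j))) id)).Realize
          (Sum.elim (fun x => a x.1 x.2.1 x.2.2) (b ((fun i j => (i j : ℕ)) '' t))) ↔ i ∈ t := by
        intro t
        rw [Formula.realize_relabel, ← hval.mem_set_image, ← h]
        refine iff_of_eq (congrArg _ (funext ?_))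
        rintro (y | y) <;> rfl
      rw [key, key]
      exact hi)
  have hκ : Fintype.card (Σ j : Fin 2, Fin n × Fin (k j)) = n * (k 0 + k 1) := by
    simp [Fin.sum_univ_two, mul_add]
  rw [hκ, Nat.card_eq_fintype_card, Fintype.card_set, Fintype.card_fun, Fintype.card_fin,
    Fintype.card_fin, sq] at hcard
  refine absurd (hcard.trans ?_) (not_le.2 hn)
  have h1 : p ^ (n * (k 0 + k 1)) + 1 ≤ 2 * p ^ (n * (k 0 + k 1)) := by
    have : 0 < p ^ (n * (k 0 + k 1)) := by positivity
    omega
  calc _ ≤ (p + 1) ^ m * (2 * p ^ (n * (k 0 + k 1))) ^ p ^ m *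
        ((p ^ (n * (k 0 + k 1))) ^ m * (p ^ m) ^ m) := by gcongr
    _ = _ := by
      rw [mul_pow, ← pow_mul, ← pow_mul, ← pow_mul p (_ + _) n, add_mul _ _ n, pow_add p]
      rw [show (k 0 + k 1) * p ^ m * n = n * (k 0 + k 1) * p ^ m by ring,
        show (k 0 + k 1) * m * n = n * (k 0 + k 1) * m by ring]
      ring

/-! ### Simplicity -/

/-- If every node of an infinite tree has infinitely many children, and the property `G s i` of the
`i`-th child of `s` holds for finitely many `i` only, then there is a branch along which it
fails. -/
theorem exists_branch {G : List ℕ → ℕ → Prop} (hG : ∀ s, {i | G s i}.Finite) :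
    ∃ σ : ℕ → ℕ, ∀ e, ¬ G (List.ofFn fun i : Fin e => σ i) (σ e) := by
  choose next hnext using fun s => (hG s).exists_notMem
  let node : ℕ → List ℕ := fun e => Nat.rec [] (fun _ s => s ++ [next s]) e
  refine ⟨fun e => next (node e), fun e => ?_⟩
  have h : ∀ e, List.ofFn (fun i : Fin e => next (node i)) = node e := fun e => by
    induction e with
    | zero => rfl
    | succ e ih => rw [List.ofFn_succ_last]; simp only [Fin.val_castSucc, ih, Fin.val_last]; rfl
  rw [h]
  exact hnext (node e)

namespace Presentation

variable {p : ℕ} {V : Type*} [AddCommGroup V] [Module (ZMod p) V]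
  {B : V →ₗ[ZMod p] V →ₗ[ZMod p] ZMod p} {K : Type*} [lang.Structure K]

/-- The linear map from coordinate vectors given by the vector parts of a tuple. -/
noncomputable def comb (P : Presentation p V B K) {m : ℕ} (x : Fin m → K) :
    (Fin m → ZMod p) →ₗ[ZMod p] V :=
  Fintype.linearCombination (ZMod p) fun i => P.vecPart (x i)

theorem comb_single (P : Presentation p V B K) {m : ℕ} (x : Fin m → K) (i : Fin m) :
    P.comb x (Pi.single i 1) = P.vecPart (x i) := by
  simp [comb]

/-- A scalar has vector part `0` by default, so the vector part can be replaced within the same sort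
only if zero is kept. -/
theorem exists_parts (P : Presentation p V B K) (k : K) (v : V) (hv : P.vecPart k = 0 → v = 0) :
    ∃ k', P.scalPart k' = P.scalPart k ∧ P.vecPart k' = v := by
  rcases P.vec_or_scal k with ⟨x, rfl⟩ | ⟨c, rfl⟩
  · exact ⟨P.vec v, by simp, by simp⟩
  · have h0 : P.vecPart (P.scal c) = 0 := by simp [vecPart]
    exact ⟨P.scal c, rfl, by rw [h0, hv h0]⟩

/-- Infinitely many instances `φ(x i; a i)` such that the `x i` satisfy no linear relations over
`A` and `a i` besides those over `A` alone admit arbitrarily large finite subfamilies with a common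
solution. -/
theorem exists_common_solution [Fact p.Prime] (P : Presentation p V B K)
    (hB : ExtensionProperty B) {m l : ℕ}
    (φ : lang.Formula (Fin m ⊕ Fin l)) {A : Submodule (ZMod p) V} (hA : A.FG) {I : Set ℕ}
    (hI : I.Infinite) (x : ℕ → Fin m → K) (a : ℕ → Fin l → K)
    (hφ : ∀ i ∈ I, φ.Realize (Sum.elim (x i) (a i)))
    (hrel : ∀ i ∈ I, ∀ e f, P.comb (x i) e + P.comb (a i) f = 0 → P.comb (x i) e ∈ A) (k : ℕ) :
    ∃ (s : Finset ℕ) (z : Fin m → K), s.card = k ∧ ∀ i ∈ s, φ.Realize (Sum.elim z (a i)) := by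
  classical
  -- the sorts and the scalars, the relations over `A`, and the Gram matrix may be assumed constant
  have := finite_of_fg hA
  obtain ⟨J₁, hJ₁I, hJ₁, ⟨sc, rl, gr⟩, hconst₁⟩ := exists_infinite_subset_const hI fun i =>
    ((fun j => P.scalPart (x i j),
      fun e => if h : P.comb (x i) e ∈ A then some (⟨_, h⟩ : A) else none,
      fun e e' => B (P.comb (x i) e) (P.comb (x i) e')) :
      (Fin m → Option (ZMod p)) × ((Fin m → ZMod p) → Option A) ×
        ((Fin m → ZMod p) → (Fin m → ZMod p) → ZMod p))
  simp only [Prod.mk.injEq] at hconst₁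
  -- The kernel `A₁` has to be found before the products with its elements can be made constant.
  obtain ⟨J₂, hJ₂J₁, hJ₂, A₁, hA₁, hflower⟩ := exists_sunflower hJ₁ fun i => P.comb (a i)
  -- and so may be the products with the elements of `A ⊔ A₁`
  have hAA₁ : (A ⊔ A₁).FG := hA.sup hA₁
  have := finite_of_fg hAA₁
  obtain ⟨J, hJJ₂, hJ, pr, hconst₂⟩ := exists_infinite_subset_const hJ₂ fun i =>
    fun (e : Fin m → ZMod p) (c : (A ⊔ A₁ : Submodule (ZMod p) V)) => B (P.comb (x i) e) c
  have hJI : J ⊆ I := hJJ₂.trans (hJ₂J₁.trans hJ₁I)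
  have hJ₁' : J ⊆ J₁ := hJJ₂.trans hJ₂J₁
  have hsc : ∀ i ∈ J, ∀ i' ∈ J, ∀ j, P.scalPart (x i j) = P.scalPart (x i' j) :=
    fun i hi i' hi' => congrFun ((hconst₁ i (hJ₁' hi)).1.trans (hconst₁ i' (hJ₁' hi')).1.symm)
  have hrl : ∀ i ∈ J, ∀ i' ∈ J, ∀ e, P.comb (x i) e ∈ A → P.comb (x i) e = P.comb (x i') e := by
    intro i hi i' hi' e he
    have h1 := congrFun ((hconst₁ i (hJ₁' hi)).2.1.trans (hconst₁ i' (hJ₁' hi')).2.1.symm) e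
    simp only [dif_pos he] at h1
    split_ifs at h1 with h2
    rwa [Option.some_inj, Subtype.mk.injEq] at h1
  have hgr : ∀ i ∈ J, ∀ i' ∈ J, ∀ e e', B (P.comb (x i) e) (P.comb (x i) e') =
      B (P.comb (x i') e) (P.comb (x i') e') := fun i hi i' hi' e e' =>
    congrFun (congrFun ((hconst₁ i (hJ₁' hi)).2.2.trans (hconst₁ i' (hJ₁' hi')).2.2.symm) e) e'
  have hpr : ∀ i ∈ J, ∀ i' ∈ J, ∀ e, ∀ c ∈ A ⊔ A₁, B (P.comb (x i) e) c = B (P.comb (x i') e) c :=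
    fun i hi i' hi' e c hc =>
      congrFun (congrFun ((hconst₂ i hi).trans (hconst₂ i' hi').symm) e) ⟨c, hc⟩
  -- glue the functionals `x i · -`
  obtain ⟨s, L, hs, hsJ, hLA, hL⟩ := exists_glue_sunflower (W := (Fin m → ZMod p) →ₗ[ZMod p] ZMod p)
    hJ (fun i => P.comb (a i)) (A := A ⊔ A₁) hAA₁
    (fun D hD => (hflower D hD).subset fun i hi =>
      ⟨hJJ₂ hi.1, fun hle => hi.2 (hle.trans le_sup_right)⟩)
    (fun i => (LinearMap.lcomp (ZMod p) (ZMod p) (P.comb (x i))).comp B.flip)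
    (fun i hi j hj c hc => LinearMap.ext fun e => hpr i hi j hj e c hc) k
  have hLA : ∀ i ∈ J, ∀ c ∈ A ⊔ A₁, ∀ e, L c e = B (P.comb (x i) e) c :=
    fun i hi c hc e => LinearMap.congr_fun (hLA i hi c hc) e
  have hL : ∀ i ∈ s, ∀ f e, L (P.comb (a i) f) e = B (P.comb (x i) e) (P.comb (a i) f) :=
    fun i hi f e => LinearMap.congr_fun (hL i hi f) e
  obtain ⟨i₀, hi₀⟩ := hJ.nonempty
  let D : Submodule (ZMod p) V := A ⊔ ⨆ i ∈ s, LinearMap.range (P.comb (a i))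
  have hD : D.FG := hA.sup (Submodule.fg_biSup s _ fun i _ => Module.Finite.iff_fg.1 inferInstance)
  have haD : ∀ i ∈ s, ∀ f, P.comb (a i) f ∈ D := fun i hi f =>
    Submodule.mem_sup_right (Submodule.mem_iSup_of_mem i (Submodule.mem_iSup_of_mem hi ⟨f, rfl⟩))
  -- A combination that lies in `A` is the same vector for all `x i`, so the products glued from
  -- different `x i` agree with those of `x i₀` there.
  have hLD : ∀ d ∈ D, ∀ e, P.comb (x i₀) e ∈ A → L d e = B (P.comb (x i₀) e) d := by
    intro d hd e he
    have : D ≤ LinearMap.ker (L.flip e - B (P.comb (x i₀) e)) := by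
      refine sup_le (fun c hc => ?_) (iSup₂_le fun i hi => ?_)
      · simp [hLA i₀ hi₀ c (Submodule.mem_sup_left hc)]
      · rintro _ ⟨f, rfl⟩
        simp [hL i hi, hrl i₀ hi₀ i (hsJ hi) e he]
    simpa [sub_eq_zero] using this hd
  -- `z` copies `x i₀` over `A` and has with each chosen `a i` the products that `x i` has. It
  -- satisfies no further relations over `D`, so with each `a i` it has the same type as `x i`.
  obtain ⟨z, hzA, hzD, hzl, hzz⟩ := exists_generic hB P.symm (P.comb (x i₀)) hD L hLD
    fun d hd e => hLA i₀ hi₀ d (Submodule.mem_sup_left hd) e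
  choose y hys hyv using fun j => P.exists_parts (x i₀ j) (z (Pi.single j 1)) fun h0 => by
    have h1 : P.comb (x i₀) (Pi.single j 1) = 0 := by rw [comb_single, h0]
    rw [hzA _ (h1 ▸ A.zero_mem), h1]
  have hyz : P.comb y = z := by
    refine LinearMap.pi_ext' fun j => LinearMap.ext_ring ?_
    simp [comb_single, hyv]
  refine ⟨s, y, hs, fun i hi => ?_⟩
  have hiJ := hsJ hi
  refine (P.realize_formula_iff_of_gram (P' := P) hB hB φ ?_ ?_ ?_).1 (hφ i (hJI hiJ))
  · rintro (j | j)
    · exact (hsc i hiJ i₀ hi₀ j).trans (hys j).symm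
    · rfl
  · have hxx : ∀ j j', B (P.vecPart (x i j)) (P.vecPart (x i j')) =
        B (P.vecPart (y j)) (P.vecPart (y j')) := fun j j' => by
      rw [← comb_single, ← comb_single, hgr i hiJ i₀ hi₀, ← hzz, hyv, hyv]
    have hxa : ∀ j j', B (P.vecPart (x i j)) (P.vecPart (a i j')) =
        B (P.vecPart (y j)) (P.vecPart (a i j')) := fun j j' => by
      rw [← comb_single, ← P.comb_single (a i), ← hL i hi, ← hzl _ _ (haD i hi _), hyv]
    rintro (j | j) (j' | j')
    · exact hxx j j'
    · exact hxa j j'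
    · exact (P.symm _ _).trans ((hxa j' j).trans (P.symm _ _))
    · rfl
  · intro e
    rw [Fintype.sum_sum_type, Fintype.sum_sum_type]
    change P.comb (x i) (fun j => e (.inl j)) + P.comb (a i) (fun j => e (.inr j)) = 0 ↔
      P.comb y (fun j => e (.inl j)) + P.comb (a i) (fun j => e (.inr j)) = 0
    generalize (fun j => e (.inl j)) = e₁
    generalize (fun j => e (.inr j)) = e₂
    rw [hyz]
    constructor
    · intro h
      have h1 := hrel i (hJI hiJ) e₁ e₂ h
      have h2 := hrl i hiJ i₀ hi₀ e₁ h1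
      rw [hzA e₁ (h2 ▸ h1), ← h2, h]
    · intro h
      have h1 : P.comb (x i₀) e₁ ∈ A := hzD _ (by
        rw [eq_neg_of_add_eq_zero_left h]
        exact D.neg_mem (haD i hi _))
      rw [← hrl i₀ hi₀ i hiJ e₁ h1, ← hzA e₁ h1, h]

end Presentation

theorem isSimpleTheory (p : ℕ) [Fact p.Prime] : ModelDividing.IsSimpleTheory (theory p) := by
  rintro m l φ ⟨N, k, a, -, hbranch, hnode⟩
  obtain ⟨V, _, _, B, P, hB⟩ := exists_presentation p N
  let A : List ℕ → Submodule (ZMod p) V := fun s =>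
    ⨆ t ∈ s.inits.toFinset, LinearMap.range (P.comb (a t))
  have hA : ∀ s, (A s).FG := fun s =>
    Submodule.fg_biSup _ _ fun t _ => Module.Finite.iff_fg.1 inferInstance
  have hmem : ∀ s f, P.comb (a s) f ∈ A s := fun s f =>
    Submodule.mem_iSup_of_mem s (Submodule.mem_iSup_of_mem (by simp) ⟨f, rfl⟩)
  have hmono : ∀ s i, A s ≤ A (s ++ [i]) := fun s i =>
    biSup_mono fun t ht => by
      simp only [List.mem_toFinset, List.mem_inits] at ht ⊢
      exact ht.trans (List.prefix_append _ _)
  let R : (Fin m → N) → List ℕ → Submodule (ZMod p) (Fin m → ZMod p) := fun x s =>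
    (A s).comap (P.comb x)
  -- The instance at the child `i` of `s` has a solution with no relations over `A (s ++ [i])`
  -- beyond those over `A s`.
  let G : List ℕ → ℕ → Prop := fun s i => ∃ x : Fin m → N,
    φ.Realize (Sum.elim x (a (s ++ [i]))) ∧ R x (s ++ [i]) ≤ R x s
  by_cases hG : ∀ s, {i | G s i}.Finite
  · obtain ⟨σ, hσ⟩ := exists_branch hG
    obtain ⟨x, hx⟩ := hbranch σ (m + 1)
    -- Along a branch that avoids `G` every step adds a relation, so after `m + 1` steps the space
    -- of relations of an `m`-tuple would have dimension above `m`.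
    have hrank : ∀ e ≤ m + 1, e ≤ Module.finrank (ZMod p) (R x (List.ofFn fun i : Fin e => σ i)) := by
      intro e he
      induction e with
      | zero => exact Nat.zero_le _
      | succ e ih =>
        have h1 : (List.ofFn fun i : Fin (e + 1) => σ i) =
            (List.ofFn fun i : Fin e => σ i) ++ [σ e] := by
          rw [List.ofFn_succ_last]; rfl
        refine (ih (by omega)).trans_lt (Submodule.finrank_lt_finrank_of_lt ?_)
        rw [h1]
        refine lt_of_le_not_ge (Submodule.comap_mono (hmono _ _)) fun hle => hσ e ⟨x, ?_, hle⟩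
        rw [← h1]
        exact hx e (by omega)
    have h2 := (hrank (m + 1) le_rfl).trans (Submodule.finrank_le _)
    rw [Module.finrank_fin_fun] at h2
    omega
  · push Not at hG
    obtain ⟨s, hs⟩ := hG
    have : ∀ i, ∃ x : Fin m → N, i ∈ {i | G s i} →
        φ.Realize (Sum.elim x (a (s ++ [i]))) ∧ R x (s ++ [i]) ≤ R x s := fun i => by
      by_cases hi : i ∈ {i | G s i}
      · obtain ⟨x, hx⟩ := hi
        exact ⟨x, fun _ => hx⟩
      · exact ⟨fun _ => P.vec 0, fun h => absurd h hi⟩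
    choose x hx using this
    obtain ⟨J, z, hJ, hz⟩ := P.exists_common_solution hB φ (hA s) hs x (fun i => a (s ++ [i]))
      (fun i hi => (hx i hi).1) (fun i hi e f h => (hx i hi).2 (by
        change P.comb (x i) e ∈ A (s ++ [i])
        rw [eq_neg_of_add_eq_zero_left h]
        exact Submodule.neg_mem _ (hmem _ _))) k
    exact hnode s J hJ ⟨z, hz⟩

/-! ### The independence property -/

instance (p : ℕ) : Nonempty (Carrier p) := ⟨Carrier.vec 0⟩

open Filter in
-- The vectors of the standard model have finite support and cannot code infinite sets `I`; an
-- ultrapower supplies vectors that do.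
theorem hasIP_one (p : ℕ) [Fact p.Prime] : ModelDividing.HasIP 1 (theory p) := by
  classical
  let U : Ultrafilter ℕ := hyperfilter ℕ
  let N : Type := (U : Filter ℕ).Product fun _ => Carrier p
  let q : (ℕ → Carrier p) → N := Quotient.mk ((U : Filter ℕ).productSetoid fun _ => Carrier p)
  have hN : N ⊨ theory p := by
    refine ⟨fun σ hσ => ?_⟩
    exact (Ultraproduct.sentence_realize σ).2 (Eventually.of_forall fun _ => hσ)
  have : Nonempty N := ⟨q fun _ => Carrier.vec 0⟩
  -- the formula `y · x₀ = x₁`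
  let t : Fin 3 → (Σ _ : Fin 1, Fin 1) ⊕ Fin 2 := ![.inl ⟨0, 0⟩, .inr 0, .inr 1]
  obtain ⟨ψ, hψ⟩ := IsElementary.isDot (t 0) (t 1) (t 2)
  -- The indicator function of `I` truncated at `n`. Its product with the `i`-th unit vector is
  -- correct as soon as `i < n`, hence for almost all `n`.
  let b : Set (Fin 1 → ℕ) → ℕ → ℕ →₀ ZMod p := fun I n =>
    Finsupp.indicator (Finset.range n) fun i _ => if (fun _ => i) ∈ I then 1 else 0
  let x : Set (Fin 1 → ℕ) → Fin 2 → ℕ → Carrier p := fun I =>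
    ![fun n => Carrier.vec (b I n), fun _ => Carrier.scal 1]
  refine ⟨fun _ => 1, 2, ψ, Theory.ModelType.of (theory p) N,
    fun _ i _ => q fun _ => Carrier.vec (Finsupp.single i 1),
    fun I j => q (x I j), fun I i => ?_⟩
  have h1 := Ultraproduct.realize_formula_cast (u := U) (M := fun _ => Carrier p) ψ
    (Sum.elim (fun y _ => Carrier.vec (Finsupp.single (i y.1) 1)) (x I))
  have h2 : (fun y => (q (Sum.elim
      (fun (y : Σ _ : Fin 1, Fin 1) _ => Carrier.vec (Finsupp.single (i y.1) 1)) (x I) y) : N)) =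
      Sum.elim (fun y => q fun _ => Carrier.vec (Finsupp.single (i y.1) 1))
        (fun j => q (x I j)) := by
    funext y
    rcases y with y | y <;> rfl
  refine Iff.trans (iff_of_eq (congrArg (ψ.Realize (M := N)) h2.symm)) (h1.trans ?_)
  have hi : (fun _ => i 0) = i := funext fun j => congrArg i (Subsingleton.elim _ _)
  have h3 : ∀ n, i 0 < n → ((ψ.Realize fun y => Sum.elim
      (fun (y : Σ _ : Fin 1, Fin 1) _ => Carrier.vec (Finsupp.single (i y.1) 1)) (x I) y n) ↔
      i ∈ I) := by
    intro n hn
    rw [hψ]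
    refine ((standardPresentation p).isDot_iff (k := Carrier.vec (Finsupp.single (i 0) 1))
      (l := Carrier.vec (b I n)) (m := Carrier.scal 1)).trans ?_
    have h4 : form (Finsupp.single (i 0) 1) (b I n) = if i ∈ I then 1 else 0 := by
      simp [form_single, b, Finsupp.indicator_apply, hn, hi]
    constructor
    · rintro ⟨u, v, hu, hv, huv⟩
      obtain rfl := Carrier.vec.inj hu
      obtain rfl := Carrier.vec.inj hv
      have h5 := Carrier.scal.inj huv
      rw [bilinForm_apply, h4] at h5
      by_contra hI
      simp [hI] at h5
    · intro hI
      refine ⟨_, _, rfl, rfl, congrArg Carrier.scal ?_⟩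
      rw [bilinForm_apply, h4, if_pos hI]
  have hev : ∀ᶠ n in (U : Filter ℕ), i 0 < n :=
    Filter.Eventually.filter_mono (Nat.hyperfilter_le_atTop) (eventually_gt_atTop (i 0))
  constructor
  · intro h
    obtain ⟨n, hn, hn'⟩ := (h.and hev).exists
    exact (h3 n hn').1 hn
  · intro h
    filter_upwards [hev] with n hn using (h3 n hn).2 h

/-! ### Subgroups of bounded index -/

theorem ExtensionProperty.infinite {F V : Type*} [Field F] [AddCommGroup V] [Module F V]
    {B : V →ₗ[F] V →ₗ[F] F} (hB : ExtensionProperty B) : Infinite V := by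
  by_contra h
  rw [not_infinite_iff_finite] at h
  obtain ⟨y, hy, -⟩ := hB ⊤ (Module.Finite.fg_top) 0 0
  exact hy trivial

theorem ExtensionProperty.exists_isotropic {F V : Type*} [Field F] [AddCommGroup V] [Module F V]
    {B : V →ₗ[F] V →ₗ[F] F} (hB : ExtensionProperty B) : ∃ w : V, w ≠ 0 ∧ B w w = 0 := by
  obtain ⟨w, hw, -, hww⟩ := hB ⊥ Submodule.fg_bot 0 0
  exact ⟨w, hw, hww⟩

namespace Presentation

variable {p : ℕ} {V : Type*} [AddCommGroup V] [Module (ZMod p) V]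
  {B : V →ₗ[ZMod p] V →ₗ[ZMod p] ZMod p} {N : Type} [lang.Structure N]

/-- The elements orthogonal to `b`. -/
def perp (P : Presentation p V B N) (b : V) : Set N := {k | IsDot k (P.vec b) (P.scal 0)}

theorem mem_perp (P : Presentation p V B N) {b x : V} : P.vec x ∈ P.perp b ↔ B x b = 0 := by
  refine P.isDot_iff.trans ⟨?_, fun h => ⟨x, b, rfl, rfl, by rw [h]⟩⟩
  rintro ⟨x', b', hx, hb, h⟩
  rw [P.vec_inj] at hx hb
  rw [hx, hb]
  exact (P.scal_injective h).symm

theorem isSubgroup_iff (P : Presentation p V B N) {H : Set N} : IsSubgroup H ↔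
    (∀ k ∈ H, ∃ x, k = P.vec x) ∧ P.vec 0 ∈ H ∧
      (∀ x y, P.vec x ∈ H → P.vec y ∈ H → P.vec (x + y) ∈ H) ∧
      ∀ x, P.vec x ∈ H → P.vec (-x) ∈ H := by
  simp only [IsSubgroup, P.isVec_iff, P.zeroVec_eq]
  refine and_congr_right fun hvec => and_congr_right fun _ => and_congr ?_ ?_
  · constructor
    · exact fun h x y hx hy => h _ hx _ hy _ (P.isAdd_iff.2 ⟨x, y, rfl, rfl, rfl⟩)
    · intro h k hk l hl z hz
      obtain ⟨x, y, rfl, rfl, rfl⟩ := P.isAdd_iff.1 hz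
      exact h x y hk hl
  · constructor
    · exact fun h x hx => h _ hx _ (P.isAdd_iff.2 ⟨x, -x, rfl, rfl, by simp⟩)
    · intro h k hk y hy
      obtain ⟨x, y, rfl, rfl, hxy⟩ := P.isAdd_iff.1 hy
      rw [P.vec_inj] at hxy
      rw [eq_neg_of_add_eq_zero_right hxy.symm]
      exact h x hk

theorem isSubgroup_isVec (P : Presentation p V B N) : IsSubgroup {k : N | IsVec k} := by
  simp only [P.isSubgroup_iff, Set.mem_ofPred_eq, P.isVec_iff, vec_inj, exists_eq', imp_self,
    implies_true, and_self]

theorem isSubgroup_inter_perp (P : Presentation p V B N) {H : Set N} (hH : IsSubgroup H) (b : V) :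
    IsSubgroup (H ∩ P.perp b) := by
  rw [P.isSubgroup_iff] at hH ⊢
  obtain ⟨h1, h2, h3, h4⟩ := hH
  refine ⟨fun k hk => h1 k hk.1, ⟨h2, P.mem_perp.2 (by simp)⟩, fun x y hx hy =>
    ⟨h3 x y hx.1 hy.1, P.mem_perp.2 ?_⟩, fun x hx => ⟨h4 x hx.1, P.mem_perp.2 ?_⟩⟩
  · rw [map_add, LinearMap.add_apply, P.mem_perp.1 hx.2, P.mem_perp.1 hy.2, add_zero]
  · rw [map_neg, LinearMap.neg_apply, P.mem_perp.1 hx.2, neg_zero]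

theorem sub_mem (P : Presentation p V B N) {H : Set N} (hH : IsSubgroup H) {x y : V}
    (hx : P.vec x ∈ H) (hy : P.vec y ∈ H) : P.vec (x - y) ∈ H := by
  rw [P.isSubgroup_iff] at hH
  rw [sub_eq_add_neg]
  exact hH.2.2.1 _ _ hx (hH.2.2.2 _ hy)

/-- The coset of a vector. -/
def coset (P : Presentation p V B N) (H : Set N) (g : V) : cosets H :=
  ⟨{z | ∃ h ∈ H, IsAdd (P.vec g) h z}, P.vec g, P.isVec_iff.2 ⟨g, rfl⟩, rfl⟩

theorem coset_surjective (P : Presentation p V B N) (H : Set N) :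
    Function.Surjective (P.coset H) := by
  rintro ⟨_, g, hg, rfl⟩
  obtain ⟨g, rfl⟩ := P.isVec_iff.1 hg
  exact ⟨g, rfl⟩

theorem vec_mem_coset (P : Presentation p V B N) {H : Set N} {g x : V} :
    P.vec x ∈ (P.coset H g : Set N) ↔ P.vec (x - g) ∈ H := by
  constructor
  · rintro ⟨h, hh, hx⟩
    obtain ⟨g', y, hg, rfl, hxy⟩ := P.isAdd_iff.1 hx
    rw [P.vec_inj] at hg hxy
    rwa [hxy, ← hg, add_sub_cancel_left]
  · exact fun h => ⟨_, h, P.isAdd_iff.2 ⟨g, x - g, rfl, rfl, by simp⟩⟩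

theorem coset_eq_iff (P : Presentation p V B N) {H : Set N} (hH : IsSubgroup H) {g g' : V} :
    P.coset H g = P.coset H g' ↔ P.vec (g - g') ∈ H := by
  have h0 := (P.isSubgroup_iff.1 hH).2.1
  constructor
  · intro h
    rw [← P.vec_mem_coset, ← h, P.vec_mem_coset, sub_self]
    exact h0
  · intro h
    refine Subtype.ext (Set.ext fun k => ?_)
    rcases P.vec_or_scal k with ⟨x, rfl⟩ | ⟨c, rfl⟩
    · rw [P.vec_mem_coset, P.vec_mem_coset]
      constructor
      · intro hx
        have := (P.isSubgroup_iff.1 hH).2.2.1 _ _ hx h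
        rwa [sub_add_sub_cancel] at this
      · intro hx
        have := P.sub_mem hH hx h
        rwa [sub_sub_sub_cancel_right] at this
    · refine iff_of_false ?_ ?_ <;>
      · rintro ⟨_, _, h⟩
        obtain ⟨_, _, _, _, h⟩ := P.isAdd_iff.1 h
        simp at h

/-- Intersecting with the orthogonal space of a vector multiplies the index by `p` at most. -/
theorem exists_cosets_inter_perp_injective (P : Presentation p V B N) {H : Set N}
    (hH : IsSubgroup H) (b : V) :
    ∃ f : cosets (H ∩ P.perp b) → cosets H × ZMod p, Function.Injective f := by
  choose g hg using P.coset_surjective (H ∩ P.perp b)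
  -- Two representatives in the same coset of `H` with equal products with `b` differ by an element
  -- of `H ∩ b^⊥`.
  refine ⟨fun C => (P.coset H (g C), B (g C) b), fun C C' h => ?_⟩
  simp only [Prod.mk.injEq, P.coset_eq_iff hH] at h
  rw [← hg C, ← hg C', P.coset_eq_iff (P.isSubgroup_inter_perp hH b)]
  exact ⟨h.1, P.mem_perp.2 (by rw [map_sub, LinearMap.sub_apply, h.2, sub_self])⟩

theorem subsingleton_cosets_isVec (P : Presentation p V B N) :
    Subsingleton (cosets {k : N | IsVec k}) := by
  refine ⟨fun C C' => ?_⟩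
  obtain ⟨g, rfl⟩ := P.coset_surjective _ C
  obtain ⟨g', rfl⟩ := P.coset_surjective _ C'
  exact (P.coset_eq_iff P.isSubgroup_isVec).2 (P.isVec_iff.2 ⟨_, rfl⟩)

theorem exists_ne_zero_of_not_injective (P : Presentation p V B N) {H : Set N}
    (hH : IsSubgroup H) (h : ¬ Function.Injective (P.coset H)) : ∃ x ≠ 0, P.vec x ∈ H := by
  rw [Function.Injective] at h
  push Not at h
  obtain ⟨x, y, hxy, hne⟩ := h
  exact ⟨x - y, sub_ne_zero.2 hne, (P.coset_eq_iff hH).1 hxy⟩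

/-- A nontrivial subgroup that is invariant under isometries contains all isotropic vectors. -/
theorem isotropic_mem [Fact p.Prime] (P : Presentation p V B N) (hB : ExtensionProperty B)
    {H : Set N} (hH : IsSubgroup H)
    (hinv : ∀ x y, x ≠ 0 → y ≠ 0 → B x x = B y y → P.vec x ∈ H → P.vec y ∈ H)
    (hne : ∃ x ≠ 0, P.vec x ∈ H) {w : V} (hw : w ≠ 0) (hww : B w w = 0) : P.vec w ∈ H := by
  obtain ⟨x, hx, hxH⟩ := hne
  -- With `y · y = y · x = x · x` the difference `x - y` is isotropic. It is nonzero and lies in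
  -- `H`, and invariance carries it to every nonzero isotropic vector.
  obtain ⟨y, hy, hyx, hyy⟩ := hB (ZMod p ∙ x) (Submodule.fg_span_singleton x) (B x) (B x x)
  have hyx := hyx x (Submodule.mem_span_singleton_self x)
  have hxy : x - y ≠ 0 := fun h => hy (sub_eq_zero.1 h ▸ Submodule.mem_span_singleton_self x)
  refine hinv (x - y) w hxy hw ?_ (P.sub_mem hH hxH (hinv x y hx ?_ hyy.symm hxH))
  · simp [hww, P.symm x y, hyx, hyy]
  · rintro rfl
    exact hy (Submodule.zero_mem _)

/-- Nonzero vectors of the same norm satisfy the same formulas. -/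
theorem realize_iff_of_norm_eq [Fact p.Prime] (P : Presentation p V B N)
    (hB : ExtensionProperty B) {α : Type} [IsEmpty α] {β : Type} [Unique β]
    (φ : lang.Formula (α ⊕ β)) (u : α → N) {x y : V} (hx : x ≠ 0) (hy : y ≠ 0)
    (hxy : B x x = B y y) :
    φ.Realize (Sum.elim u fun _ => P.vec x) ↔ φ.Realize (Sum.elim u fun _ => P.vec y) := by
  obtain ⟨S, hS, hv⟩ := exists_isPartialIsometry (Q := B) (B := B) (fun _ : Unit => x) (fun _ => y)
    (fun _ _ => hxy) (fun e => by simp [hx, hy])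
  refine realize_formula_iff (P := P) (P' := P) hB hB φ hS ?_
  rintro (i | i)
  · exact isEmptyElim i
  · exact Or.inl ⟨x, y, rfl, rfl, hv ()⟩

end Presentation

/-! ### Elementary embeddings and large extensions -/

theorem IsElementary.iff_of_elementaryEmbedding {α : Type}
    {Q : ∀ (K : Type) [lang.Structure K], (α → K) → Prop} (hQ : IsElementary Q)
    {N N' : Type} [lang.Structure N] [lang.Structure N'] (f : N ↪ₑ[lang] N') (v : α → N) :
    Q N' (f ∘ v) ↔ Q N v := by
  obtain ⟨φ, hφ⟩ := hQ
  rw [← hφ, ← hφ, f.map_formula]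

section Embedding

variable {p : ℕ} {V V' : Type*} [AddCommGroup V] [Module (ZMod p) V] [AddCommGroup V']
  [Module (ZMod p) V'] {B : V →ₗ[ZMod p] V →ₗ[ZMod p] ZMod p}
  {B' : V' →ₗ[ZMod p] V' →ₗ[ZMod p] ZMod p} {N N' : Type} [lang.Structure N] [lang.Structure N']

theorem Presentation.exists_map_vec (P : Presentation p V B N) (P' : Presentation p V' B' N')
    (f : N ↪ₑ[lang] N') (x : V) : ∃ y, f (P.vec x) = P'.vec y :=
  P'.isVec_iff.1 (((IsElementary.isVec ()).iff_of_elementaryEmbedding f fun _ => P.vec x).2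
    (P.isVec_iff.2 ⟨x, rfl⟩))

theorem Presentation.map_vec_zero (P : Presentation p V B N) (P' : Presentation p V' B' N')
    (f : N ↪ₑ[lang] N') : f (P.vec 0) = P'.vec 0 := by
  rw [← P.zeroVec_eq, ← P'.zeroVec_eq]
  exact ((IsElementary.eq_zeroVec ()).iff_of_elementaryEmbedding f fun _ => zeroVec N).2 rfl

theorem Presentation.isDot_map (f : N ↪ₑ[lang] N') (x y z : N) :
    IsDot (f x) (f y) (f z) ↔ IsDot x y z :=
  (IsElementary.isDot (0 : Fin 3) 1 2).iff_of_elementaryEmbedding f ![x, y, z]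

/-- The scalar `0` is not a symbol of the language, but it is definable as the product of the zero
vector with itself. -/
theorem Presentation.map_scal_zero (P : Presentation p V B N) (P' : Presentation p V' B' N')
    (f : N ↪ₑ[lang] N') : f (P.scal 0) = P'.scal 0 := by
  have h := (isDot_map f (P.vec 0) (P.vec 0) (P.scal 0)).2
    (P.isDot_iff.2 ⟨0, 0, rfl, rfl, by simp⟩)
  rw [P.map_vec_zero P'] at h
  obtain ⟨x, y, hx, hy, h⟩ := P'.isDot_iff.1 h
  rw [P'.vec_inj] at hx
  rw [h, ← hx]
  simp

end Embedding

/-- Every model has elementary extensions with arbitrarily many vectors. -/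
theorem exists_large_extension (p : ℕ) [Fact p.Prime] (N : Type) [lang.Structure N]
    [hN : N ⊨ theory p] (κ : Cardinal.{0}) :
    ∃ (N' : Type) (_ : lang.Structure N') (_ : N ↪ₑ[lang] N') (V : Type) (_ : AddCommGroup V)
      (_ : Module (ZMod p) V) (B : V →ₗ[ZMod p] V →ₗ[ZMod p] ZMod p) (_ : Presentation p V B N'),
      N' ⊨ theory p ∧ ExtensionProperty B ∧ κ < Cardinal.mk V := by
  obtain ⟨V, _, _, B, P, hB⟩ := exists_presentation p N
  have := hB.infinite
  have : Infinite N := Infinite.of_injective P.vec P.vec_injective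
  have hcountable : lang.card ≤ Cardinal.aleph0 := by
    have h1 : Countable (Σ n, lang.Functions n) := by
      have : ∀ n, Countable (lang.Functions n) := fun n =>
        have : Subsingleton (Func n) := ⟨fun a b => by cases a; cases b; rfl⟩
        inferInstanceAs (Countable (Func n))
      infer_instance
    have h2 : Countable (Σ n, lang.Relations n) := by
      have : ∀ n, Countable (lang.Relations n) := fun n => by
        have hinj : Function.Injective fun r : Rel n => (match r with
          | .vec => 0 | .scal => 1 | .add => 2 | .dot => 3 : ℕ) := by
          intro a b h
          cases a <;> cases b <;> first | rfl | simp at h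
        exact hinj.countable
      infer_instance
    exact Cardinal.mk_le_aleph0_iff.2 inferInstance
  let μ := max κ (Cardinal.mk N)
  have hμ : Cardinal.aleph0 ≤ μ := (Cardinal.aleph0_le_mk N).trans (le_max_right _ _)
  obtain ⟨N', ⟨f⟩, hN'⟩ := exists_elementaryEmbedding_card_eq_of_ge lang N (Order.succ μ)
    (by simpa using hcountable.trans (hμ.trans (Order.le_succ μ)))
    (by simpa using (le_max_right _ _).trans (Order.le_succ μ))
  have hT : N' ⊨ theory p := (f.theory_model_iff (theory p)).1 hN
  obtain ⟨V', i₁, i₂, B', P', hB'⟩ := exists_presentation p N'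
  refine ⟨N', inferInstance, f, V', i₁, i₂, B', P', hT, hB', ?_⟩
  -- The scalar sort is finite, so the vectors must account for the cardinality `succ μ` of `N'`.
  refine (le_max_left κ (Cardinal.mk N)).trans_lt (not_le.1 fun hV => ?_)
  have hsurj : Function.Surjective (Sum.elim P'.vec P'.scal) := fun k => by
    rcases P'.vec_or_scal k with ⟨x, rfl⟩ | ⟨c, rfl⟩
    exacts [⟨.inl x, rfl⟩, ⟨.inr c, rfl⟩]
  have h1 := Cardinal.mk_le_of_surjective hsurj
  rw [hN', Cardinal.mk_sum, Cardinal.lift_id, Cardinal.lift_id] at h1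
  refine absurd (h1.trans (Cardinal.add_le_of_le hμ hV ?_)) (not_le.2 (Order.lt_succ μ))
  exact (Cardinal.lt_aleph0_of_finite _).le.trans hμ

/-- The intersection of a type-definable subgroup of bounded index with the orthogonal space of a
vector is again one. -/
theorem exists_isBoundedSubgroup_inter_perp {p : ℕ} [Fact p.Prime] {V : Type*} [AddCommGroup V]
    [Module (ZMod p) V] {B : V →ₗ[ZMod p] V →ₗ[ZMod p] ZMod p} {N N' : Type} [lang.Structure N]
    [lang.Structure N'] [hN' : N' ⊨ theory p] {A : Set N} {π : Set (lang.Formula (A ⊕ Unit))}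
    (hπ : IsBoundedSubgroup π) (f : N ↪ₑ[lang] N') (P : Presentation p V B N') (b : V) :
    ∃ ρ : Set (lang.Formula ((Set.univ : Set N') ⊕ Unit)), IsBoundedSubgroup ρ ∧
      solutions ρ (id : N' → N') = solutions π f ∩ P.perp b := by
  obtain ⟨χ, hχ⟩ := IsElementary.isDot (α := (Set.univ : Set N') ⊕ Unit) (.inr ())
    (.inl ⟨P.vec b, trivial⟩) (.inl ⟨P.scal 0, trivial⟩)
  let ι : A ⊕ Unit → (Set.univ : Set N') ⊕ Unit := Sum.map (fun a => ⟨f a, trivial⟩) id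
  let ρ : Set (lang.Formula ((Set.univ : Set N') ⊕ Unit)) :=
    insert χ ((fun φ : lang.Formula (A ⊕ Unit) => φ.relabel ι) '' π)
  have hρ : ∀ (M : Type) [lang.Structure M] (g : N' → M), solutions ρ g =
      solutions π (g ∘ f) ∩ {k | IsDot k (g (P.vec b)) (g (P.scal 0))} := by
    intro M _ g
    ext k
    have hι : (Sum.elim (fun a : (Set.univ : Set N') => g a) fun _ => k) ∘ ι =
        Sum.elim (fun a : A => (g ∘ f) a) fun _ => k := by
      funext i; rcases i with i | i <;> rfl
    simp only [solutions, ρ, Set.forall_mem_insert, Set.forall_mem_image, Formula.realize_relabel,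
      hι, hχ, Set.mem_ofPred_eq, Set.mem_inter_iff, Sum.elim_inl, Sum.elim_inr]
    exact and_comm
  refine ⟨ρ, ?_, hρ N' id⟩
  obtain ⟨κ, hκ⟩ := hπ
  -- The factor `p` by which the index may grow is the same in all extensions.
  refine ⟨κ * Cardinal.mk (ZMod p), fun M _ g => ?_⟩
  have hM : M ⊨ theory p := (g.theory_model_iff (theory p)).1 hN'
  obtain ⟨W, _, _, C, R, -⟩ := exists_presentation p M
  obtain ⟨b', hb'⟩ := P.exists_map_vec R g b
  obtain ⟨h1, h2⟩ := hκ M (g.comp f)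
  have h3 : solutions ρ g = solutions π (g.comp f) ∩ R.perp b' := by
    rw [hρ, hb', P.map_scal_zero R]
    rfl
  rw [h3]
  refine ⟨R.isSubgroup_inter_perp h1 b', ?_⟩
  obtain ⟨F, hF⟩ := R.exists_cosets_inter_perp_injective h1 b'
  refine (Cardinal.mk_le_of_injective hF).trans ?_
  rw [Cardinal.mk_prod, Cardinal.lift_id, Cardinal.lift_id]
  gcongr

/-! ### Failure of minimality and of absoluteness -/

theorem Presentation.exists_ne_zero_mem_solutions {p : ℕ} {V : Type} [AddCommGroup V]
    [Module (ZMod p) V] {B : V →ₗ[ZMod p] V →ₗ[ZMod p] ZMod p} {N' : Type} [lang.Structure N']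
    (P : Presentation p V B N') {H : Set N'} (hH : IsSubgroup H)
    (h : Cardinal.mk (cosets H) < Cardinal.mk V) : ∃ x ≠ 0, P.vec x ∈ H :=
  P.exists_ne_zero_of_not_injective hH fun hinj =>
    absurd (Cardinal.mk_le_of_injective hinj) (not_le.2 h)

/-- In an extension with more vectors than the index allows, the subgroup contains some `x ≠ 0`, and
intersecting it with `b^⊥` for a `b` with `b · x ≠ 0` removes `x`. -/
theorem not_hasMinimalBddSubgroup (p : ℕ) [Fact p.Prime] :
    ¬ HasMinimalBddSubgroup (theory p) := by
  rintro ⟨N, _, _, A, π, hπ, hmin⟩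
  obtain ⟨κ, hκ⟩ := id hπ
  obtain ⟨N', _, f, V, _, _, B, P, hN', hB, hV⟩ := exists_large_extension p N κ
  obtain ⟨x, hx, hxπ⟩ := P.exists_ne_zero_mem_solutions (hκ N' f).1 ((hκ N' f).2.trans_lt hV)
  obtain ⟨b, hb⟩ := hB.nondegenerate hx
  obtain ⟨ρ, hρ, hρeq⟩ := exists_isBoundedSubgroup_inter_perp hπ f P b
  have h := hmin N' f _ ρ hρ (hρeq ▸ Set.inter_subset_left)
  rw [hρeq] at h
  have hx' := (h.symm ▸ hxπ : P.vec x ∈ solutions π f ∩ P.perp b).2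
  rw [P.mem_perp, P.symm] at hx'
  exact hb hx'

/-- The whole group has index one; it is the starting point for intersections with orthogonal
spaces. -/
theorem isBoundedSubgroup_isVec (p : ℕ) [Fact p.Prime] {N : Type} [lang.Structure N]
    [hN : N ⊨ theory p] : ∃ π : Set (lang.Formula ((∅ : Set N) ⊕ Unit)), IsBoundedSubgroup π := by
  obtain ⟨φ, hφ⟩ := IsElementary.isVec (α := (∅ : Set N) ⊕ Unit) (.inr ())
  have hsol : ∀ (M : Type) [lang.Structure M] (g : N → M),
      solutions {φ} g = {k | IsVec k} := fun M _ g => by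
    ext k
    simp [solutions, hφ]
  refine ⟨{φ}, ⟨1, fun M _ g => ?_⟩⟩
  have hM : M ⊨ theory p := (g.theory_model_iff (theory p)).1 hN
  obtain ⟨W, _, _, C, R, -⟩ := exists_presentation p M
  have := R.subsingleton_cosets_isVec
  rw [hsol]
  exact ⟨R.isSubgroup_isVec, Cardinal.le_one_iff_subsingleton.2 this⟩

instance carrier_models (p : ℕ) : Carrier p ⊨ theory p :=
  inferInstanceAs (Carrier p ⊨ lang.completeTheory (Carrier p))

/-- A nonzero isotropic `w` lies in every `∅`-definable subgroup of finite index, since such a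
subgroup is nonzero and invariant. With parameters, `b^⊥` for some `b` with `b · w ≠ 0` excludes it.
-/
theorem not_hasAbsoluteFinComponent (p : ℕ) [Fact p.Prime] :
    ¬ HasAbsoluteFinComponent (theory p) := by
  intro h
  have h := h (Carrier p) Set.univ
  let P := standardPresentation p
  have hB := bilinForm_extensionProperty (p := p)
  obtain ⟨w, hw, hww⟩ := hB.exists_isotropic
  have hmem : P.vec w ∈ finComponent (∅ : Set (Carrier p)) := by
    rintro H ⟨hdef, hH, hfin⟩
    have := hB.infinite
    have : Finite (cosets H) := hfin
    obtain ⟨φ, hφ⟩ := Set.definable_iff_exists_formula_sum.1 hdef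
    have hiff : ∀ k, k ∈ H ↔ φ.Realize (Sum.elim (fun a : (∅ : Set (Carrier p)) => (a : Carrier p))
        fun _ : Fin 1 => k) := fun k => Set.ext_iff.1 hφ fun _ => k
    refine P.isotropic_mem hB hH (fun x y hx hy hxy hxH => ?_) ?_ hw hww
    · rw [hiff] at hxH ⊢
      exact (P.realize_iff_of_norm_eq hB φ _ hx hy hxy).1 hxH
    · exact P.exists_ne_zero_of_not_injective hH (not_injective_infinite_finite _)
  obtain ⟨b, hb⟩ := hB.nondegenerate hw
  rw [← h] at hmem
  have hsub : {k : Carrier p | IsVec k} ∩ P.perp b = P.perp b := by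
    refine Set.inter_eq_right.2 fun k hk => ?_
    obtain ⟨x, _, rfl, _⟩ := P.isDot_iff.1 hk
    exact P.isVec_iff.2 ⟨x, rfl⟩
  have hperp := hmem (P.perp b) ⟨?_, ?_, ?_⟩
  · rw [P.mem_perp, P.symm] at hperp
    exact hb hperp
  · obtain ⟨χ, hχ⟩ := IsElementary.isDot (α := (Set.univ : Set (Carrier p)) ⊕ Fin 1) (.inr 0)
      (.inl ⟨P.vec b, trivial⟩) (.inl ⟨P.scal 0, trivial⟩)
    exact Set.definable_iff_exists_formula_sum.2 ⟨χ, Set.ext fun k =>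
      (hχ (Carrier p) (Sum.elim Subtype.val k)).symm⟩
  · rw [← hsub]
    exact P.isSubgroup_inter_perp P.isSubgroup_isVec b
  · rw [← hsub]
    obtain ⟨F, hF⟩ := P.exists_cosets_inter_perp_injective P.isSubgroup_isVec b
    have := P.subsingleton_cosets_isVec
    exact Finite.of_injective F hF

/-- The same vector works, but a subgroup of bounded index may be zero in the standard model. Its
nontriviality is used in a large extension, and membership of `w` is pulled back by elementarity. -/
theorem not_hasAbsoluteBddComponent (p : ℕ) [Fact p.Prime] :
    ¬ HasAbsoluteBddComponent (theory p) := by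
  intro h
  have h := h (Carrier p) Set.univ
  let P := standardPresentation p
  have hB := bilinForm_extensionProperty (p := p)
  obtain ⟨w, hw, hww⟩ := hB.exists_isotropic
  have hmem : P.vec w ∈ bddComponent (∅ : Set (Carrier p)) := by
    rintro π ⟨κ, hκ⟩
    obtain ⟨N', _, f, V, _, _, B', P', hN', hB', hV⟩ := exists_large_extension p (Carrier p) κ
    obtain ⟨w', hw'⟩ := P.exists_map_vec P' f w
    have hw'0 : w' ≠ 0 := by
      rintro rfl
      rw [← P.map_vec_zero P' f] at hw'
      exact hw (P.vec_injective (f.injective hw'))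
    have hww' : B' w' w' = 0 := by
      have h1 := (Presentation.isDot_map f (P.vec w) (P.vec w) (P.scal 0)).2 (P.mem_perp.2 hww)
      rw [hw', P.map_scal_zero P'] at h1
      exact P'.mem_perp.1 h1
    have hmem' : P'.vec w' ∈ solutions π f := by
      refine P'.isotropic_mem hB' (hκ N' f).1 (fun x y hx hy hxy hxH φ hφ => ?_)
        (P'.exists_ne_zero_mem_solutions (hκ N' f).1 ((hκ N' f).2.trans_lt hV)) hw'0 hww'
      exact (P'.realize_iff_of_norm_eq hB' φ _ hx hy hxy).1 (hxH φ hφ)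
    intro φ hφ
    rw [← f.map_formula]
    have h1 := hmem' φ hφ
    rw [← hw'] at h1
    convert h1 using 1
    funext i
    rcases i with i | i <;> rfl
  obtain ⟨b, hb⟩ := hB.nondegenerate hw
  rw [← h] at hmem
  obtain ⟨π, hπ⟩ := isBoundedSubgroup_isVec p (N := Carrier p)
  obtain ⟨ρ, hρ, hρeq⟩ := exists_isBoundedSubgroup_inter_perp hπ
    (FirstOrder.Language.ElementaryEmbedding.refl lang (Carrier p)) P b
  have h1 := hmem ρ hρ
  rw [hρeq] at h1
  have h2 := P.mem_perp.1 h1.2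
  rw [P.symm] at h2
  exact hb h2

end BilinearSpace

theorem mainTheorem4 (p : ℕ) [Fact p.Prime] :
    ModelDividing.IsDependent 2 (BilinearSpace.theory p) ∧
    ModelDividing.IsSimpleTheory (BilinearSpace.theory p) ∧
    ModelDividing.HasIP 1 (BilinearSpace.theory p) ∧
    ¬ BilinearSpace.HasAbsoluteFinComponent (BilinearSpace.theory p) ∧
    ¬ BilinearSpace.HasAbsoluteBddComponent (BilinearSpace.theory p) ∧
    ¬ BilinearSpace.HasMinimalBddSubgroup (BilinearSpace.theory p) := by
  exact ⟨BilinearSpace.isDependent_two p, BilinearSpace.isSimpleTheory p,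
    BilinearSpace.hasIP_one p, BilinearSpace.not_hasAbsoluteFinComponent p,
    BilinearSpace.not_hasAbsoluteBddComponent p, BilinearSpace.not_hasMinimalBddSubgroup p⟩
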